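/- Let $r,c\ge 2$. Write $[x,y]=x^{-1}y^{-1}xy$, let $\Gamma_1\ge\Gamma_2\ge\cdots$ denote the lower central series of a group, and let $N_{r,c}(\mathbb Z)=F_r/\Gamma_{c+1}(F_r)$, where $F_r$ is the free group of rank $r$. Let $\mathbf u=(u_{11},\dots,u_{1n_1},u_{21},\dots,u_{cn_c})$ be a Hall basic sequence of $N_{r,c}(\mathbb Z)$, i.e. for every $1\le i\le c$ we have $u_{ij}\in\Gamma_i$ and the cosets $u_{ij}\Gamma_{i+1}$, $1\le j\le n_i$, form a basis of the free abelian group $\Gamma_i/\Gamma_{i+1}$ (for example, the basic commutators in a free generating set); here $n_1=r$. Put $I=\{(i,j):1\le i\le c,\ 1\le j\le n_i\}$, ordered lexicographically, and for a tuple $\mathbf a=(a_{ij})_{(i,j)\in I}$ of integers let $\mathbf u^{\mathbf a}=\prod_{(i,j)\in I}u_{ij}^{a_{ij}}$ (ordered product) and $\mathbf u_k^{\mathbf a}=\prod_{(i,j)\in I,\ i\ge k}u_{ij}^{a_{ij}}$. (A) There are polynomials $p_{ij}(\mathbf x,\mathbf y)$, $q_{ij}(\mathbf x,z)$ and $t^{ijkl}_{mn}(x,y)$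 with rational coefficients, each an integer combination of products of binomial coefficients of single variables, such that for all integer arguments $$\mathbf u^{\mathbf a}\mathbf u^{\mathbf b}=\mathbf u^{p(\mathbf a,\mathbf b)},\qquad (\mathbf u^{\mathbf a})^{l}=\mathbf u^{q(\mathbf a,l)},\qquad [u_{ij}^a,u_{kl}^b]=\mathbf u_{i+k}^{\mathbf t^{ijkl}(a,b)} .$$ (B) Fix such polynomials. Let $R$ be a binomial domain (an integral domain of characteristic zero in which $a(a-1)\cdots(a-k+1)$ is divisible by $k!$ for all $a\in R$, $k\ge1$), so that the above polynomials can be evaluated in $R$. For $1\le j\le r$ let $f^j=(f^j_1,\dots,f^j_{n_c}):R^+\times R^+\to\bigoplus_{s=1}^{n_c}R^+$ be a symmetric $2$-cocycle, i.e. $f^j(x+y,z)+f^j(x,y)=f^j(x,y+z)+f^j(y,z)$, $f^j(0,x)=f^j(x,0)=0$ and $f^j(x,y)=f^j(y,x)$. Let $N_{r,c}(R,\bar f)$ be the set of formal products $\mathbf u^{\mathbf a}$, $\mathbf a\in R^I$, with $\mathbf u^{\mathbf a}\mathbf u^{\mathbf b}=\mathbf u^{\mathbf d}$ and $(\mathbf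 u^{\mathbf a})^{-1}=\mathbf u^{\mathbf m}$, where $$d_{ij}=p_{ij}(\mathbf a,\mathbf b),\quad m_{ij}=q_{ij}(\mathbf a,-1)\quad(i<c),$$ $$d_{cj}=p_{cj}(\mathbf a,\mathbf b)+\sum_{k=1}^r f^k_j(a_{1k},b_{1k}),\quad m_{cj}=q_{cj}(\mathbf a,-1)-\sum_{k=1}^r f^k_j(a_{1k},-a_{1k}).$$ (For $\bar f=0$ this is the P. Hall completion $N_{r,c}(R)$.) Let $u_{ij}^a$ denote the formal product with exponent $a$ at $(i,j)$ and exponent $0$ elsewhere. Then $N_{r,c}(R,\bar f)$ is a group with this multiplication and this inversion, it is generated by the elements $u_{ij}^a$, $(i,j)\in I$, $a\in R$, and it is defined on these generators by the relations, for all $a,b\in R$, 1. $[u_{ij}^a,u_{kl}^b]=\mathbf u_{i+k}^{\mathbf t^{ijkl}(a,b)}$ for all $(i,j),(k,l)\in I$ (the right-hand side is $1$ if $i+k>c$); 2. $u_{ij}^au_{ij}^b=u_{ij}^{a+b}$ for $2\le i\le c$, $1\le j\le n_i$; 3. $u_{1j}^au_{1j}^b=u_{1j}^{a+b}\,\mathbf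 u_c^{f^j(a,b)}$ for $1\le j\le r$. -/

import Mathlib

namespace HallCompletion

/-! ### Free nilpotent groups and Hall basic sequences -/

/-- The commutator `[x, y] = x⁻¹ y⁻¹ x y`. -/
def comm {G : Type*} [Group G] (x y : G) : G := x⁻¹ * y⁻¹ * x * y

/-- The lower central series numbered from `1`: `Γ₁ = G`, `Γ_{i+1} = [Γ_i, G]`
(Mathlib numbers it from `0`). -/
def Gam (G : Type*) [Group G] (i : ℕ) : Subgroup G := (⊤ : Subgroup G).lowerCentralSeries (i - 1)

instance (G : Type*) [Group G] (i : ℕ) : (Gam G i).Normal := by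
  unfold Gam; infer_instance

/-- The free nilpotent group `N_{r,c}(ℤ) = F(r) / Γ_{c+1}(F(r))` of rank `r` and class `c`. -/
abbrev FreeNilpotent (r c : ℕ) : Type := FreeGroup (Fin r) ⧸ Gam (FreeGroup (Fin r)) (c + 1)

/-- The index set `I = {(i, j) : 1 ≤ i ≤ c, 1 ≤ j ≤ n_i}`; both coordinates are shifted down
by one, so that `⟨i, j⟩` stands for the pair `(i + 1, j + 1)`. -/
abbrev Index {c : ℕ} (n : Fin c → ℕ) : Type := Σ i : Fin c, Fin (n i)

/-- The weight of an index, that is, its first coordinate, counted from `1`. -/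
def wt {c : ℕ} {n : Fin c → ℕ} (x : Index n) : ℕ := x.1.val + 1

/-- The indices of weight exactly `k`. -/
abbrev Layer {c : ℕ} (n : Fin c → ℕ) (k : ℕ) : Type := {x : Index n // wt x = k}

/-- All indices in lexicographic order. -/
def indices {c : ℕ} (n : Fin c → ℕ) : List (Index n) :=
  (List.finRange c).flatMap fun i => (List.finRange (n i)).map fun j => ⟨i, j⟩

/-- The product of the `g x` over all indices `x` of weight at least `k`, taken in lexicographic
order. With `g x = u x ^ a x` this is the element `𝐮_k^𝐚`; for `k = 1` it is `𝐮^𝐚`. -/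
def orderedProd {c : ℕ} {n : Fin c → ℕ} {G : Type*} [Group G] (k : ℕ) (g : Index n → G) : G :=
  (((indices n).filter fun x => k ≤ wt x).map g).prod

/-- A Hall basic sequence of `N_{r,c}(ℤ)`: a tuple `(u_{ij})`, `1 ≤ i ≤ c`, `1 ≤ j ≤ n_i`, such
that for each `i` the cosets `u_{ij} Γ_{i+1}` generate `Γ_i / Γ_{i+1}` freely as an abelian group,
that is, every coset is `∏_j (u_{ij} Γ_{i+1})^{a_j}` for exactly one integer tuple `a`. The
sequences formed by basic commutators in a free generating set are of this kind. -/
structure HallBasicSequence (r c : ℕ) where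
  n : Fin c → ℕ
  u : Index n → FreeNilpotent r c
  mem : ∀ x, u x ∈ Gam (FreeNilpotent r c) (wt x)
  free : ∀ i : Fin c, ∀ g ∈ Gam (FreeNilpotent r c) (i.val + 1),
    ∃! a : Fin (n i) → ℤ,
      ((List.ofFn fun j => u ⟨i, j⟩ ^ a j).prod)⁻¹ * g ∈ Gam (FreeNilpotent r c) (i.val + 2)

/-- `𝐮^𝐚` for an integer tuple `𝐚`. -/
def HallBasicSequence.word {r c : ℕ} (U : HallBasicSequence r c) (a : Index U.n → ℤ) :
    FreeNilpotent r c :=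
  orderedProd 1 fun x => U.u x ^ a x

/-! ### Canonical polynomials -/

/-- A polynomial in the variables `σ` with rational coefficients that is an integer combination
of products of binomial coefficients `∏_i (X_i choose k_i)`: to each exponent vector `k` the
coefficient of the corresponding product. -/
abbrev NumPoly (σ : Type*) : Type _ := (σ →₀ ℕ) →₀ ℤ

/-- The value of such a polynomial at a point of a binomial ring. -/
noncomputable def NumPoly.eval {σ R : Type*} [CommRing R] [BinomialRing R] (p : NumPoly σ)
    (v : σ → R) : R :=
  p.sum fun k z => (z : R) * k.prod fun i m => Ring.choose (v i) m

/-- The canonical polynomials of a Hall basic sequence `𝐮`: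
* `mul` are the `p_x(𝐚, 𝐛)` with `𝐮^𝐚 𝐮^𝐛 = 𝐮^{p(𝐚, 𝐛)}`,
* `pow` are the `q_x(𝐚, l)` with `(𝐮^𝐚)^l = 𝐮^{q(𝐚, l)}`,
* `com` are the `t^{xy}_z(a, b)` with `[u_x^a, u_y^b] = 𝐮_{i+k}^{t^{xy}(a, b)}`, where `i` and `k`
  are the weights of `x` and `y`,
for all integer arguments. -/
structure CanonicalPolynomials {r c : ℕ} (U : HallBasicSequence r c) where
  mul : Index U.n → NumPoly (Index U.n ⊕ Index U.n)
  pow : Index U.n → NumPoly (Index U.n ⊕ Unit)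
  com : Index U.n → Index U.n → Index U.n → NumPoly (Fin 2)
  mul_spec : ∀ a b : Index U.n → ℤ,
    U.word a * U.word b = U.word fun x => (mul x).eval (Sum.elim a b)
  pow_spec : ∀ (a : Index U.n → ℤ) (l : ℤ),
    U.word a ^ l = U.word fun x => (pow x).eval (Sum.elim a fun _ => l)
  com_spec : ∀ (x y : Index U.n) (a b : ℤ),
    comm (U.u x ^ a) (U.u y ^ b) =
      orderedProd (wt x + wt y) fun z => U.u z ^ (com x y z).eval ![a, b]

/-! ### Abelian deformations -/

/-- A (normalised) symmetric 2-cocycle `B × B → A` of abelian groups. -/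
structure SymmetricCocycle (B A : Type*) [AddCommGroup B] [AddCommGroup A] where
  toFun : B → B → A
  cocycle : ∀ x y z, toFun (x + y) z + toFun x y = toFun x (y + z) + toFun y z
  zero_left : ∀ x, toFun 0 x = 0
  zero_right : ∀ x, toFun x 0 = 0
  symm : ∀ x y, toFun x y = toFun y x

section Deformation

variable {r c : ℕ} {U : HallBasicSequence r c} {R : Type*} [CommRing R] [BinomialRing R]

/-- A tuple indexed by the indices of weight `c`, extended by `0` to all indices. -/
def extendTop {n : Fin c → ℕ} (v : Layer n c → R) (x : Index n) : R :=
  if h : wt x = c then v ⟨x, h⟩ else 0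

/-- The underlying set of `N_{r,c}(R, f̄)`: the formal products `𝐮^𝐚`, each given by its tuple
`𝐚` of exponents in `R`. There is one cocycle `f^j : R⁺ × R⁺ → ⊕_{n_c} R⁺` for each `u_{1j}`. -/
@[ext] structure QN (_P : CanonicalPolynomials U)
    (_f : Layer U.n 1 → SymmetricCocycle R (Layer U.n c → R)) where
  coord : Index U.n → R

variable {P : CanonicalPolynomials U} {f : Layer U.n 1 → SymmetricCocycle R (Layer U.n c → R)}

/-- The product of `N_{r,c}(R, f̄)`: the exponents are `p_{ij}(𝐚, 𝐛)`, and for `i = c` the sum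
`∑_k f^k_j(a_{1k}, b_{1k})` is added. For `f̄ = 0` this is the product of `N_{r,c}(R)`. -/
noncomputable def QN.mul (g h : QN P f) : QN P f :=
  ⟨fun x => (P.mul x).eval (Sum.elim g.coord h.coord) +
    extendTop (∑ k : Layer U.n 1, (f k).toFun (g.coord k) (h.coord k)) x⟩

/-- The inverse in `N_{r,c}(R, f̄)`: the exponents are `q_{ij}(𝐚, -1)`, and for `i = c` the sum
`∑_k f^k_j(a_{1k}, -a_{1k})` is subtracted. -/
noncomputable def QN.inv (g : QN P f) : QN P f :=
  ⟨fun x => (P.pow x).eval (Sum.elim g.coord fun _ => -1) -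
    extendTop (∑ k : Layer U.n 1, (f k).toFun (g.coord k) (-g.coord k)) x⟩

/-- The element `u_x^a` of `N_{r,c}(R, f̄)`: the formal product with exponent `a` at `x` and
exponent `0` elsewhere. -/
def QN.gen (P : CanonicalPolynomials U) (f : Layer U.n 1 → SymmetricCocycle R (Layer U.n c → R))
    (x : Index U.n) (a : R) : QN P f :=
  ⟨Pi.single x a⟩

/-- The relators, in the free group on the symbols `u_x^a`, `x ∈ I`, `a ∈ R`. -/
inductive IsRelator (P : CanonicalPolynomials U)
    (f : Layer U.n 1 → SymmetricCocycle R (Layer U.n c → R)) : FreeGroup (Index U.n × R) → Prop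
  /-- `[u_x^a, u_y^b] = 𝐮_{i+k}^{t^{xy}(a, b)}`, where `i`, `k` are the weights of `x`, `y`. -/
  | commutator (x y : Index U.n) (a b : R) : IsRelator P f
      (comm (FreeGroup.of (x, a)) (FreeGroup.of (y, b)) *
        (orderedProd (wt x + wt y) fun z => FreeGroup.of (z, (P.com x y z).eval ![a, b]))⁻¹)
  /-- `u_x^a u_x^b = u_x^{a + b}` for `x` of weight at least `2`. -/
  | add (x : Index U.n) (hx : 2 ≤ wt x) (a b : R) : IsRelator P f
      (FreeGroup.of (x, a) * FreeGroup.of (x, b) * (FreeGroup.of (x, a + b))⁻¹)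
  /-- `u_{1j}^a u_{1j}^b = u_{1j}^{a + b} 𝐮_c^{f^j(a, b)}`. -/
  | addOne (j : Layer U.n 1) (a b : R) : IsRelator P f
      (FreeGroup.of (j.1, a) * FreeGroup.of (j.1, b) *
        (FreeGroup.of (j.1, a + b) *
          orderedProd c fun z => FreeGroup.of (z, extendTop ((f j).toFun a b) z))⁻¹)

end Deformation

end HallCompletion

/-!
The argument has two halves, one over `ℤ` and one over the binomial domain `R`.

Over `ℤ`, the lexicographic order makes a Hall basic sequence `u` a central sequence: the commutator
of `u_x` and `u_y` lies in the subgroup generated by the elements that come after both. For such a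
sequence let `polyMaps` be the group of maps from `ℤ^σ` generated by the maps `s ↦ u_x ^ p(s)` with
`p` a numerical function, that is, an integer-valued polynomial; these are the integer combinations
of products of binomial coefficients (`isNumerical_iff`). The multiplication, power and commutator
maps clearly belong to this group, or are obtained from its elements by summation in one variable,
so canonical polynomials exist once polynomial maps are known to have normal forms
`s ↦ ∏ u_x ^ p_x(s)` with numerical `p_x`. The collection process (`exists_eq_prod_of_mem_genSub`)
gives these normal forms as soon as conjugation by `u_x ^ p(s)` preserves the polynomial maps of the
elements after `u_x`. This is proved together with the closure under summation, by induction along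
the sequence (`conj_mem_polyMaps`, `closedUnderSummation`): with `w = u_y⁻¹ u_x⁻¹ u_y u_x`, the map
`a ↦ u_y⁻¹ u_x⁻ᵃ u_y u_xᵃ` is the sum of the conjugates `u_x⁻ᵃ w u_xᵃ`, where `w` involves only
elements after `u_y`.

Exponents are unique over `ℤ` (`HallBasicSequence.word_injective`), so each group identity yields
polynomial identities between exponents, valid at all integer points. They are identities between
rational polynomials and hence hold in `R`, which embeds into a field of characteristic `0`
(`SamePolynomial.transfer`). The cocycles depend on the exponents of weight one, which are additive,
and change only the central exponents of weight `c`, so the group laws survive the deformation; and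
commutators do not change, because the cocycles are symmetric. Thus the defining relations hold in
`N_{r,c}(R, f̄)`. Conversely they allow the collection process in the presented group, so that every
element of it has the form `𝐮^𝐚`; as `𝐮^𝐚` is mapped to the tuple `𝐚`, the map from the
presented group is bijective.
-/

namespace HallCompletion

/-! ### Numerical functions -/

section NumericalFunctions

open MvPolynomial

/-- The product of binomial coefficients `∏_i (v_i choose k_i)`. -/
def binomProd {σ R : Type*} [CommRing R] [BinomialRing R] (v : σ → R) (k : σ →₀ ℕ) : R :=
  k.prod fun i m => Ring.choose (v i) m

theorem map_binomProd {σ R S : Type*} [CommRing R] [BinomialRing R] [CommRing S] [BinomialRing S]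
    (φ : R →+* S) (v : σ → R) (k : σ →₀ ℕ) :
    φ (binomProd v k) = binomProd (fun i => φ (v i)) k := by
  simp only [binomProd, map_finsuppProd, Ring.map_choose]

theorem NumPoly.map_eval {σ R S : Type*} [CommRing R] [BinomialRing R] [CommRing S]
    [BinomialRing S] (φ : R →+* S) (p : NumPoly σ) (v : σ → R) :
    φ (p.eval v) = p.eval fun i => φ (v i) := by
  simp only [NumPoly.eval, map_finsuppSum, map_mul, map_intCast]
  exact Finsupp.sum_congr fun k _ => by rw [← binomProd, ← binomProd, map_binomProd]

theorem choose_mul_self {R : Type*} [CommRing R] [BinomialRing R] (x : R) (m : ℕ) :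
    Ring.choose x m * x = (m + 1) • Ring.choose x (m + 1) + m • Ring.choose x m := by
  have := BinomialRing.toIsAddTorsionFree (R := R)
  have h := Ring.descPochhammer_eq_factorial_smul_choose x (m + 1)
  rw [descPochhammer_succ_right, Polynomial.smeval_mul,
    Ring.descPochhammer_eq_factorial_smul_choose] at h
  refine nsmul_right_injective (Nat.factorial_ne_zero m) ?_
  simp only [Polynomial.smeval_sub, Polynomial.smeval_X, Polynomial.smeval_natCast, nsmul_eq_mul,
    Nat.factorial_succ, Nat.cast_mul, Nat.cast_succ, pow_zero, pow_one] at h ⊢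
  linear_combination h

theorem binomProd_eq_mul_erase {σ R : Type*} [CommRing R] [BinomialRing R] (v : σ → R)
    (k : σ →₀ ℕ) (i : σ) :
    binomProd v k = Ring.choose (v i) (k i) * binomProd v (k.erase i) :=
  (Finsupp.mul_prod_erase' k i _ fun _ => Ring.choose_zero_right _).symm

theorem erase_add_single_self {σ : Type*} (k : σ →₀ ℕ) (i : σ) :
    (k + Finsupp.single i 1).erase i = k.erase i := by
  simp [Finsupp.erase_add]

theorem binomProd_mul_var {σ R : Type*} [CommRing R] [BinomialRing R] (v : σ → R) (k : σ →₀ ℕ)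
    (i : σ) : binomProd v k * v i =
      (k i + 1) • binomProd v (k + Finsupp.single i 1) + k i • binomProd v k := by
  rw [binomProd_eq_mul_erase v k i, binomProd_eq_mul_erase v (k + _) i, erase_add_single_self,
    mul_right_comm, choose_mul_self]
  simp [add_mul, mul_assoc]

/-- The products of binomial coefficients of the variables span the polynomials over `ℚ`. -/
theorem mem_span_binomProd {σ : Type*} (Q : MvPolynomial σ ℚ) :
    Q ∈ Submodule.span ℚ (Set.range (binomProd (X : σ → MvPolynomial σ ℚ))) := by
  induction Q using MvPolynomial.induction_on with
  | C a =>
    have h : C a = a • binomProd (X : σ → MvPolynomial σ ℚ) 0 := by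
      simp [binomProd, MvPolynomial.C_eq_smul_one]
    rw [h]
    exact Submodule.smul_mem _ _ (Submodule.subset_span ⟨0, rfl⟩)
  | add p q hp hq => exact add_mem hp hq
  | mul_X p i hp =>
    induction hp using Submodule.span_induction with
    | mem x hx =>
      obtain ⟨k, rfl⟩ := hx
      rw [binomProd_mul_var]
      exact add_mem (nsmul_mem (Submodule.subset_span (Set.mem_range_self _)) _)
        (nsmul_mem (Submodule.subset_span (Set.mem_range_self _)) _)
    | zero => simp
    | add x y _ _ hx hy => rw [add_mul]; exact add_mem hx hy
    | smul a x _ hx => rw [smul_mul_assoc]; exact Submodule.smul_mem _ _ hx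

theorem binomProd_natCast_self {σ : Type*} (k : σ →₀ ℕ) :
    binomProd (fun i => ((k i : ℤ))) k = 1 :=
  Finset.prod_eq_one fun i _ => by simp [Ring.choose_natCast]

theorem le_of_binomProd_natCast_ne_zero {σ : Type*} {k l : σ →₀ ℕ}
    (h : binomProd (fun i => ((k i : ℤ))) l ≠ 0) : l ≤ k := by
  intro i
  by_contra! hi
  refine h (Finset.prod_eq_zero (i := i) (Finsupp.mem_support_iff.2 (by omega)) ?_)
  beta_reduce
  rw [Ring.choose_natCast, Nat.choose_eq_zero_of_lt hi, Nat.cast_zero]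

/-- An integer-valued function on `ℤ^σ` is *numerical* if it is an integer combination of products
of binomial coefficients of the coordinates. -/
def IsNumerical {σ : Type*} (F : (σ → ℤ) → ℤ) : Prop :=
  ∃ p : NumPoly σ, ∀ s, F s = p.eval s

/-- The multivariate Pólya theorem: the integer-valued polynomials with rational coefficients are
the numerical functions. The products of binomial coefficients span the polynomials over `ℚ`, and
by induction on `k` the coefficient of `binomProd · k` is an integer: at the point `k` this product
is `1` and the products that do not vanish have exponents below `k`. -/
theorem isNumerical_iff {σ : Type*} {F : (σ → ℤ) → ℤ} :
    IsNumerical F ↔ ∃ Q : MvPolynomial σ ℚ, ∀ s, (F s : ℚ) = eval (fun i => (s i : ℚ)) Q := by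
  constructor
  · rintro ⟨p, hp⟩
    refine ⟨p.eval X, fun s => ?_⟩
    rw [NumPoly.map_eval, hp, ← eq_intCast (Int.castRingHom ℚ), NumPoly.map_eval]
    simp
  · rintro ⟨Q, hQ⟩
    obtain ⟨c, hc⟩ := (Finsupp.mem_span_range_iff_exists_finsupp).1 (mem_span_binomProd Q)
    have hF (s : σ → ℤ) : (F s : ℚ) = c.sum fun k z => z * (binomProd s k : ℤ) := by
      rw [hQ, ← hc, map_finsuppSum]
      refine Finsupp.sum_congr fun k _ => ?_
      rw [smul_eval, map_binomProd, ← eq_intCast (Int.castRingHom ℚ), map_binomProd]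
      simp
    have hint (k : σ →₀ ℕ) : c k ∈ (Int.castRingHom ℚ).range := by
      classical
      induction hn : k.degree using Nat.strong_induction_on generalizing k with
      | _ n ih =>
      subst hn
      by_cases hk : k ∈ c.support
      · have h := hF fun i => k i
        rw [Finsupp.sum, ← Finset.add_sum_erase _ _ hk, binomProd_natCast_self, Int.cast_one,
          mul_one] at h
        rw [← sub_eq_iff_eq_add] at h
        rw [← h]
        refine sub_mem ⟨_, rfl⟩ (sum_mem fun l hl => ?_)
        by_cases h0 : binomProd (fun i => ((k i : ℤ))) l = 0
        · rw [h0, Int.cast_zero, mul_zero]; exact zero_mem _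
        · have hle := le_of_binomProd_natCast_ne_zero h0
          have hlt : l < k := lt_of_le_of_ne hle (Finset.ne_of_mem_erase hl)
          refine mul_mem (ih l.degree ?_ l rfl) ⟨_, rfl⟩
          obtain ⟨d, rfl⟩ := exists_add_of_le hle
          have hd : d ≠ 0 := by rintro rfl; simp at hlt
          have : d.degree ≠ 0 := by rwa [Ne, Finsupp.degree_eq_zero_iff]
          simp only [map_add]; omega
      · rw [Finsupp.notMem_support_iff.1 hk]; exact zero_mem _
    -- As the coefficients are integers, they equal their numerators.
    refine ⟨c.mapRange Rat.num Rat.num_zero, fun s => ?_⟩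
    rw [← Int.cast_inj (α := ℚ), hF, NumPoly.eval, Finsupp.sum_mapRange_index (by simp),
      ← eq_intCast (Int.castRingHom ℚ), map_finsuppSum]
    refine Finsupp.sum_congr fun k _ => ?_
    obtain ⟨z, hz⟩ := hint k
    rw [← hz]
    simp [binomProd]

theorem isNumerical_const {σ : Type*} (z : ℤ) : IsNumerical fun _ : σ → ℤ => z :=
  isNumerical_iff.2 ⟨C (z : ℚ), fun s => by simp⟩

theorem isNumerical_var {σ : Type*} (i : σ) : IsNumerical fun s : σ → ℤ => s i :=
  isNumerical_iff.2 ⟨X i, fun s => by simp⟩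

theorem IsNumerical.add {σ : Type*} {F G : (σ → ℤ) → ℤ} (hF : IsNumerical F)
    (hG : IsNumerical G) : IsNumerical (F + G) := by
  obtain ⟨P, hP⟩ := isNumerical_iff.1 hF
  obtain ⟨Q, hQ⟩ := isNumerical_iff.1 hG
  exact isNumerical_iff.2 ⟨P + Q, fun s => by simp [hP, hQ]⟩

theorem IsNumerical.neg {σ : Type*} {F : (σ → ℤ) → ℤ} (hF : IsNumerical F) :
    IsNumerical (-F) := by
  obtain ⟨P, hP⟩ := isNumerical_iff.1 hF
  exact isNumerical_iff.2 ⟨-P, fun s => by simp [hP]⟩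

theorem IsNumerical.comp {σ τ : Type*} {F : (σ → ℤ) → ℤ} (hF : IsNumerical F)
    {φ : (τ → ℤ) → σ → ℤ} (hφ : ∀ i, IsNumerical fun s => φ s i) :
    IsNumerical fun s => F (φ s) := by
  obtain ⟨P, hP⟩ := isNumerical_iff.1 hF
  choose Q hQ using fun i => isNumerical_iff.1 (hφ i)
  refine isNumerical_iff.2 ⟨aeval Q P, fun s => ?_⟩
  rw [hP, ← coe_aeval_eq_eval, ← coe_aeval_eq_eval, RingHom.coe_coe, RingHom.coe_coe,
    ← AlgHom.comp_apply, comp_aeval]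
  simp [hQ, aeval_eq_eval]

/-- A numerical function has an antidifference in each variable, again numerical: on binomial
coefficients of that variable it raises the lower index by one. -/
theorem IsNumerical.exists_antidifference {σ : Type*} [DecidableEq σ] {F : (σ → ℤ) → ℤ}
    (hF : IsNumerical F) (i : σ) :
    ∃ S : (σ → ℤ) → ℤ, IsNumerical S ∧ (∀ s, s i = 0 → S s = 0) ∧
      ∀ s, S (Function.update s i (s i + 1)) = S s + F s := by
  obtain ⟨p, hp⟩ := hF
  have hu (s : σ → ℤ) (k : σ →₀ ℕ) (z : ℤ) :
      binomProd (Function.update s i z) (k.erase i) = binomProd s (k.erase i) := by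
    refine Finset.prod_congr rfl fun j hj => ?_
    have hji : j ≠ i := by rintro rfl; simp at hj
    simp only [Function.update_of_ne hji]
  refine ⟨fun s => p.sum fun k z => z * binomProd s (k + Finsupp.single i 1),
    ⟨p.mapDomain (· + Finsupp.single i 1), fun s => ?_⟩, fun s hs => ?_, fun s => ?_⟩
  · rw [NumPoly.eval, Finsupp.sum_mapDomain_index (by simp) (by simp [add_mul])]
    simp [binomProd]
  · refine Finset.sum_eq_zero fun k _ => ?_
    simp only [binomProd_eq_mul_erase s (k + _) i, hs, Finsupp.add_apply, Finsupp.single_eq_same,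
      Ring.choose_zero_succ, zero_mul, mul_zero]
  · simp only [hp, NumPoly.eval, Finsupp.sum]
    rw [← Finset.sum_add_distrib]
    refine Finset.sum_congr rfl fun k _ => ?_
    rw [← binomProd, binomProd_eq_mul_erase _ (k + _) i, binomProd_eq_mul_erase s (k + _) i,
      binomProd_eq_mul_erase s k i, erase_add_single_self, hu]
    simp only [Function.update_self, Finsupp.add_apply, Finsupp.single_eq_same,
      Ring.choose_succ_succ, Int.cast_id]
    ring

end NumericalFunctions

/-! ### The collection process and polynomial maps -/

section Collection

variable {ι A G : Type*} [Group G]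

/-- The subgroup generated by the symbols `g x a` with `x` in the list `L`. -/
def genSub (g : ι → A → G) (L : List ι) : Subgroup G :=
  Subgroup.closure {h | ∃ x ∈ L, ∃ a, g x a = h}

theorem mem_genSub (g : ι → A → G) {L : List ι} {x : ι} (hx : x ∈ L) (a : A) :
    g x a ∈ genSub g L :=
  Subgroup.subset_closure ⟨x, hx, a, rfl⟩

theorem genSub_mono (g : ι → A → G) {L M : List ι} (h : ∀ x ∈ L, x ∈ M) :
    genSub g L ≤ genSub g M :=
  Subgroup.closure_mono fun _ ⟨x, hx, a, e⟩ => ⟨x, h x hx, a, e⟩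

theorem genSub_nil (g : ι → A → G) : genSub g [] = ⊥ := by
  simp [genSub]

theorem prod_map_mem_genSub (g : ι → A → G) (L : List ι) (a : ι → A) :
    (L.map fun x => g x (a x)).prod ∈ genSub g L := by
  refine Subgroup.list_prod_mem _ fun y hy => ?_
  obtain ⟨x, hx, rfl⟩ := List.mem_map.1 hy
  exact mem_genSub g hx _

theorem conj_mem_genSub {g : ι → A → G} {L : List ι} {v : G}
    (hconj : ∀ y ∈ L, ∀ b, v⁻¹ * g y b * v ∈ genSub g L) {h : G} (hh : h ∈ genSub g L) :
    v⁻¹ * h * v ∈ genSub g L := by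
  have : genSub g L ≤ (genSub g L).comap (MulAut.conj v⁻¹).toMonoidHom := by
    refine (Subgroup.closure_le _).2 ?_
    rintro _ ⟨y, hy, b, rfl⟩
    simpa [MulAut.conj_apply] using hconj y hy b
  simpa [MulAut.conj_apply] using this hh

/-- If the symbols of `L` are normalized by those of `x`, and `g x` is additive modulo the subgroup
they generate, then one symbol of `x` can be collected to the left of any word in the symbols of
`x :: L`. -/
theorem exists_inv_mul_mem_genSub [AddGroup A] {g : ι → A → G} {x : ι} {L : List ι}
    (hconj : ∀ y ∈ L, ∀ a b, (g x a)⁻¹ * g y b * g x a ∈ genSub g L)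
    (hadd : ∀ a b, (g x (a + b))⁻¹ * (g x a * g x b) ∈ genSub g L)
    {h : G} (hh : h ∈ genSub g (x :: L)) : ∃ a, (g x a)⁻¹ * h ∈ genSub g L := by
  have hc (a : A) {k : G} (hk : k ∈ genSub g L) : (g x a)⁻¹ * k * g x a ∈ genSub g L :=
    conj_mem_genSub (fun y hy b => hconj y hy a b) hk
  have h0 : g x 0 ∈ genSub g L := by simpa using hadd 0 0
  -- `(g x a)⁻¹` agrees with `g x (-a)` up to a factor from the later symbols.
  have hneg (a : A) : g x (-a) * g x a ∈ genSub g L := by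
    have h1 := hadd (-a) a
    rw [neg_add_cancel] at h1
    exact (Subgroup.mul_mem_cancel_left _ (inv_mem h0)).1 h1
  induction hh using Subgroup.closure_induction_left with
  | one => exact ⟨0, by simpa using h0⟩
  | mul_left k hk h _ ih =>
    obtain ⟨a, ha⟩ := ih
    obtain ⟨y, hy, b, rfl⟩ := hk
    rcases List.mem_cons.1 hy with rfl | hy
    · exact ⟨b + a, by simpa [mul_assoc] using mul_mem (hadd b a) ha⟩
    · exact ⟨a, by simpa [mul_assoc] using mul_mem (hc a (mem_genSub g hy b)) ha⟩
  | inv_mul_cancel k hk h _ ih =>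
    obtain ⟨a, ha⟩ := ih
    obtain ⟨y, hy, b, rfl⟩ := hk
    rcases List.mem_cons.1 hy with rfl | hy
    · refine ⟨-b + a, ?_⟩
      simpa [mul_assoc] using
        mul_mem (mul_mem (hc (-b + a) (inv_mem (hneg b))) (hadd (-b) a)) ha
    · exact ⟨a, by simpa [mul_assoc] using mul_mem (hc a (inv_mem (mem_genSub g hy b))) ha⟩

/-- The collection process: if the symbols of each suffix of `L` are normalized by, and contain the
additivity defects of, the preceding symbols, then every element of the subgroup generated by the
symbols of `L` is an ordered product `∏ g x (a x)`, with one factor for each `x` in `L`. -/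
theorem exists_eq_prod_of_mem_genSub [AddGroup A] {g : ι → A → G} {L : List ι} (hL : L.Nodup)
    (hconj : ∀ x M, x :: M <:+ L → ∀ y ∈ M, ∀ a b, (g x a)⁻¹ * g y b * g x a ∈ genSub g M)
    (hadd : ∀ x M, x :: M <:+ L → ∀ a b, (g x (a + b))⁻¹ * (g x a * g x b) ∈ genSub g M)
    {h : G} (hh : h ∈ genSub g L) : ∃ a : ι → A, h = (L.map fun x => g x (a x)).prod := by
  classical
  induction L generalizing h with
  | nil => exact ⟨0, by simpa [genSub_nil] using hh⟩
  | cons x L ih =>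
    obtain ⟨a, ha⟩ := exists_inv_mul_mem_genSub (hconj x L List.suffix_rfl)
      (hadd x L List.suffix_rfl) hh
    obtain ⟨b, hb⟩ := ih hL.of_cons
      (fun y M hM => hconj y M (hM.trans (List.suffix_cons x L)))
      (fun y M hM => hadd y M (hM.trans (List.suffix_cons x L))) ha
    refine ⟨Function.update b x a, ?_⟩
    rw [List.map_cons, List.prod_cons, Function.update_self, List.map_congr_left
      (g := fun y => g y (b y)), ← hb, mul_inv_cancel_left]
    intro y hy
    rw [Function.update_of_ne]
    rintro rfl
    exact (List.nodup_cons.1 hL).1 hy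

end Collection

section PolynomialMaps

/-- The additive group of numerical functions on `ℤ^σ`. -/
def numericalSub (σ : Type) : AddSubgroup ((σ → ℤ) → ℤ) where
  carrier := {F | IsNumerical F}
  zero_mem' := isNumerical_const 0
  add_mem' := IsNumerical.add
  neg_mem' := IsNumerical.neg

variable {ι G : Type*} [Group G]

/-- The map `ℤ^σ → G`, `s ↦ u_x ^ p(s)`, for a numerical function `p`. -/
def numPow (u : ι → G) (σ : Type) (x : ι) (p : numericalSub σ) : (σ → ℤ) → G :=
  fun s => u x ^ p.1 s

theorem numPow_add (u : ι → G) {σ : Type} (x : ι) (p q : numericalSub σ) :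
    numPow u σ x (p + q) = numPow u σ x p * numPow u σ x q :=
  funext fun s => zpow_add (u x) (p.1 s) (q.1 s)

/-- The group of maps `ℤ^σ → G` generated by the maps `s ↦ u_x ^ p(s)`, for `x` in `L` and `p`
numerical. -/
abbrev polyMaps (u : ι → G) (L : List ι) (σ : Type) : Subgroup ((σ → ℤ) → G) :=
  genSub (numPow u σ) L

theorem pow_mem_polyMaps (u : ι → G) {L : List ι} {x : ι} (hx : x ∈ L) {σ : Type}
    {p : (σ → ℤ) → ℤ} (hp : IsNumerical p) : (fun s => u x ^ p s) ∈ polyMaps u L σ :=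
  mem_genSub (numPow u σ) hx ⟨p, hp⟩

theorem polyMaps_comp {u : ι → G} {L : List ι} {σ τ : Type} {F : (σ → ℤ) → G}
    (hF : F ∈ polyMaps u L σ) {φ : (τ → ℤ) → σ → ℤ} (hφ : ∀ i, IsNumerical fun s => φ s i) :
    (fun s => F (φ s)) ∈ polyMaps u L τ := by
  induction hF using Subgroup.closure_induction with
  | mem F hF =>
    obtain ⟨x, hx, p, rfl⟩ := hF
    exact pow_mem_polyMaps u hx (p.2.comp hφ)
  | one => exact one_mem _
  | mul _ _ _ _ h1 h2 => exact mul_mem h1 h2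
  | inv _ _ h => exact inv_mem h

theorem const_mem_polyMaps {u : ι → G} {L : List ι} (σ : Type) {w : G}
    (hw : w ∈ Subgroup.closure (u '' {x | x ∈ L})) : (fun _ => w) ∈ polyMaps u L σ := by
  induction hw using Subgroup.closure_induction with
  | mem w hw =>
    obtain ⟨x, hx, rfl⟩ := hw
    simpa using pow_mem_polyMaps u hx (isNumerical_const (σ := σ) 1)
  | one => exact one_mem _
  | mul _ _ _ _ h1 h2 => exact mul_mem h1 h2
  | inv _ _ h => exact inv_mem h

/-- The property that the polynomial maps of `L` are closed under summation in one variable: a map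
`F` with value `1` where the variable vanishes is polynomial if the quotients `F(s)⁻¹ F(s + eᵢ)` of
its consecutive values are given by a polynomial map. -/
def ClosedUnderSummation (u : ι → G) (L : List ι) : Prop :=
  ∀ (σ : Type) [DecidableEq σ] (i : σ) (F h : (σ → ℤ) → G), h ∈ polyMaps u L σ →
    (∀ s, s i = 0 → F s = 1) → (∀ s, F (Function.update s i (s i + 1)) = F s * h s) →
    F ∈ polyMaps u L σ

/-- Powers with numerical exponents are sums of constant terms. -/
theorem ClosedUnderSummation.zpow {u : ι → G} {L : List ι} (hL : ClosedUnderSummation u L)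
    {σ : Type} {h : (σ → ℤ) → G} (hh : h ∈ polyMaps u L σ) {q : (σ → ℤ) → ℤ}
    (hq : IsNumerical q) : (fun s => h s ^ q s) ∈ polyMaps u L σ := by
  classical
  -- The exponent is first a new variable `none`, and then replaced by `q`.
  have key := hL (Option σ) none (fun t => h (fun j => t (some j)) ^ t none)
    (fun t => h fun j => t (some j)) (polyMaps_comp hh fun j => isNumerical_var (some j))
    (fun s hs => by simp [hs]) (fun s => by simp [zpow_add_one])
  refine polyMaps_comp (φ := fun s o => o.elim (q s) s) key ?_
  rintro (_ | i)
  exacts [hq, isNumerical_var i]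

/-- Conjugation by a power of `u_x` with numerical exponent preserves the polynomial maps of the
later elements. For a single `u_y` the map `a ↦ u_y⁻¹ u_x⁻ᵃ u_y u_xᵃ` is the sum of the conjugates
of `u_y⁻¹ u_x⁻¹ u_y u_x`, which involves only elements later than `u_y`. -/
theorem conj_mem_polyMaps {u : ι → G} {x : ι} {L : List ι}
    (hsum : ∀ M, M <:+ L → ClosedUnderSummation u M)
    (hcomm : ∀ y M, y :: M <:+ L →
      (u y)⁻¹ * (u x)⁻¹ * u y * u x ∈ Subgroup.closure (u '' {z | z ∈ M}))
    {σ : Type} {p : (σ → ℤ) → ℤ} (hp : IsNumerical p) {h : (σ → ℤ) → G}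
    (hh : h ∈ polyMaps u L σ) :
    (fun s => (u x ^ p s)⁻¹ * h s * u x ^ p s) ∈ polyMaps u L σ := by
  induction L generalizing σ with
  | nil =>
    rw [polyMaps, genSub_nil, Subgroup.mem_bot] at hh ⊢
    subst hh
    funext s
    simp
  | cons y L ih =>
    have ih' {σ : Type} {p : (σ → ℤ) → ℤ} (hp : IsNumerical p) {h : (σ → ℤ) → G} :=
      ih (fun M hM => hsum M (hM.trans (List.suffix_cons y L)))
        (fun z M hM => hcomm z M (hM.trans (List.suffix_cons y L))) hp (h := h)
    -- `u_y⁻¹ u_x⁻ᵃ u_y u_xᵃ` as a polynomial map of one variable `a`.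
    have hW := hsum L (List.suffix_cons y L) Unit ()
      (fun s => (u y)⁻¹ * (u x ^ s ())⁻¹ * u y * u x ^ s ())
      (fun s => (u x ^ s ())⁻¹ * ((u y)⁻¹ * (u x)⁻¹ * u y * u x) * u x ^ s ())
      (ih' (isNumerical_var ()) (const_mem_polyMaps Unit (hcomm y L List.suffix_rfl)))
      (fun s hs => by simp [hs])
      (fun s => by simp only [Function.update_self, zpow_add_one]; group)
    have hE : (fun s : σ → ℤ => (u x ^ p s)⁻¹ * u y * u x ^ p s) ∈ polyMaps u (y :: L) σ := by
      have h1 := polyMaps_comp (φ := fun s _ => p s) hW fun _ => hp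
      convert mul_mem (pow_mem_polyMaps u (List.mem_cons_self (a := y) (l := L))
        (isNumerical_const (σ := σ) 1)) (genSub_mono _ (fun z => List.mem_cons_of_mem y) h1)
        using 1
      funext s
      simp [mul_assoc]
    refine conj_mem_genSub (v := fun s => u x ^ p s) ?_ hh
    intro z hz q
    rcases List.mem_cons.1 hz with rfl | hz
    · convert (hsum _ List.suffix_rfl).zpow hE q.2 using 1
      funext s
      have := conj_zpow (i := q.1 s) (a := (u x ^ p s)⁻¹) (b := u z)
      rw [inv_inv] at this
      exact this.symm
    · exact genSub_mono _ (fun z => List.mem_cons_of_mem y) (ih' hp (mem_genSub _ hz q))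

/-- Polynomial maps are closed under summation, by induction on the list: the antidifference of the
exponent of the first element is split off, and what remains is the sum of a polynomial map of the
later elements. -/
theorem closedUnderSummation {u : ι → G} {L : List ι}
    (hcomm : ∀ x N, x :: N <:+ L → ∀ y M, y :: M <:+ N →
      (u y)⁻¹ * (u x)⁻¹ * u y * u x ∈ Subgroup.closure (u '' {z | z ∈ M})) :
    ∀ M, M <:+ L → ClosedUnderSummation u M := by
  induction L with
  | nil =>
    intro M hM σ _ i F h hh h0 h1
    rw [List.suffix_nil.1 hM] at hh ⊢
    rw [polyMaps, genSub_nil, Subgroup.mem_bot] at hh ⊢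
    subst hh
    have hs (s : σ → ℤ) (z : ℤ) : F (Function.update s i z) = 1 := by
      induction z with
      | zero => exact h0 _ (by simp)
      | succ n ih => simpa [ih] using h1 (Function.update s i n)
      | pred n ih => simpa [ih] using (h1 (Function.update s i (-n - 1))).symm
    funext s
    simpa using hs s (s i)
  | cons x L ih =>
    have hL := ih fun y N hN => hcomm y N (hN.trans (List.suffix_cons x L))
    intro M hM
    rcases List.suffix_cons_iff.1 hM with rfl | hM
    swap
    · exact hL M hM
    have hconj {σ : Type} {p : (σ → ℤ) → ℤ} (hp : IsNumerical p) {h : (σ → ℤ) → G} :=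
      conj_mem_polyMaps hL (hcomm x L List.suffix_rfl) hp (h := h)
    intro σ _ i F h hh h0 h1
    obtain ⟨p, hp⟩ := exists_inv_mul_mem_genSub (g := numPow u σ) (x := x) (L := L)
      (fun y hy a b => hconj a.2 (mem_genSub (numPow u σ) hy b))
      (fun a b => by rw [numPow_add, inv_mul_cancel]; exact one_mem _) hh
    obtain ⟨S, hS, hS0, hS1⟩ := p.2.exists_antidifference i
    -- The consecutive quotients of `F u_x⁻ˢ` are conjugates of the part `u_x⁻ᵖ h` of `h` that
    -- belongs to the later elements.
    have hT := hL L List.suffix_rfl σ i (fun s => F s * (u x ^ S s)⁻¹)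
      (fun s => (u x ^ (-S s + -p.1 s))⁻¹ * ((u x ^ p.1 s)⁻¹ * h s) * u x ^ (-S s + -p.1 s))
      (hconj (hS.neg.add p.2.neg) hp)
      (fun s hs => by simp [h0 s hs, hS0 s hs])
      (fun s => by
        simp only [h1, hS1]
        group)
    convert mul_mem (genSub_mono _ (fun z => List.mem_cons_of_mem x) hT)
      (pow_mem_polyMaps u (List.mem_cons_self (a := x) (l := L)) hS) using 1
    funext s
    simp

/-- The polynomial maps of a central sequence have numerical coordinates. -/
theorem exists_numerical_exponents {u : ι → G} {L : List ι} (hnd : L.Nodup)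
    (hcomm : ∀ x N, x :: N <:+ L → ∀ y M, y :: M <:+ N →
      (u y)⁻¹ * (u x)⁻¹ * u y * u x ∈ Subgroup.closure (u '' {z | z ∈ M}))
    {σ : Type} {F : (σ → ℤ) → G} (hF : F ∈ polyMaps u L σ) :
    ∃ p : ι → NumPoly σ, ∀ s, F s = (L.map fun x => u x ^ (p x).eval s).prod := by
  obtain ⟨a, ha⟩ := exists_eq_prod_of_mem_genSub hnd (g := numPow u σ)
    (fun x M hM y hy a b => conj_mem_polyMaps
      (fun N hN => closedUnderSummation hcomm N
        (hN.trans ((List.suffix_cons x M).trans hM)))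
      (hcomm x M hM) a.2 (mem_genSub (numPow u σ) hy b))
    (fun x M _ a b => by rw [numPow_add, inv_mul_cancel]; exact one_mem _) hF
  choose p hp using fun x => (a x).2
  refine ⟨p, fun s => ?_⟩
  rw [ha, Pi.list_prod_apply, List.map_map]
  simp [Function.comp_def, numPow, hp]

end PolynomialMaps

/-! ### Words in a Hall basic sequence -/

section Indices

variable {c : ℕ} {n : Fin c → ℕ}

theorem mem_indices (x : Index n) : x ∈ indices n := by
  simp only [indices, List.mem_flatMap, List.mem_map, List.mem_finRange, true_and]
  exact ⟨x.1, x.2, rfl⟩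

theorem wt_le (x : Index n) : wt x ≤ c := x.1.isLt

theorem pairwise_wt_indices : (indices n).Pairwise fun x y => wt x ≤ wt y := by
  rw [indices, List.pairwise_flatMap]
  constructor
  · intro i _
    rw [List.pairwise_map]
    exact List.pairwise_of_forall fun _ _ => le_rfl
  · refine (List.pairwise_lt_finRange c).imp fun {i j} hij x hx y hy => ?_
    obtain ⟨_, _, rfl⟩ := List.mem_map.1 hx
    obtain ⟨_, _, rfl⟩ := List.mem_map.1 hy
    exact Nat.succ_le_succ hij.le

theorem nodup_indices : (indices n).Nodup := by
  rw [indices, List.nodup_flatMap]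
  constructor
  · intro i _
    exact (List.nodup_finRange _).map fun a b h => by simpa using h
  · refine (List.nodup_finRange c).imp fun {i j} hij x hx hy => hij ?_
    obtain ⟨_, _, rfl⟩ := List.mem_map.1 hx
    obtain ⟨_, _, h⟩ := List.mem_map.1 hy
    exact (congrArg Sigma.fst h).symm

/-- The indices of weight greater than that of `x` come after `x`. -/
theorem mem_of_cons_suffix_indices {x y : Index n} {M : List (Index n)}
    (h : x :: M <:+ indices n) (hxy : wt x < wt y) : y ∈ M := by
  obtain ⟨K, hK⟩ := h
  have hy := mem_indices y
  have hp := pairwise_wt_indices (n := n)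
  rw [← hK] at hy hp
  rcases List.mem_append.1 hy with hy | hy
  · have := (List.pairwise_append.1 hp).2.2 y hy x List.mem_cons_self
    omega
  · rcases List.mem_cons.1 hy with rfl | hy
    · omega
    · exact hy

theorem wt_le_of_cons_suffix_indices {x y : Index n} {M : List (Index n)}
    (h : x :: M <:+ indices n) (hy : y ∈ M) : wt x ≤ wt y :=
  List.rel_of_pairwise_cons (pairwise_wt_indices.sublist h.sublist) hy

variable {G : Type*} [Group G]

theorem orderedProd_one (g : Index n → G) : orderedProd 1 g = ((indices n).map g).prod := by
  rw [orderedProd, List.filter_eq_self.2]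
  intro x _
  simp [wt]

theorem orderedProd_eq_ite (k : ℕ) (g : Index n → G) :
    orderedProd k g = orderedProd 1 fun x => if k ≤ wt x then g x else 1 := by
  rw [orderedProd_one, orderedProd]
  induction indices n with
  | nil => rfl
  | cons x L ih => by_cases h : k ≤ wt x <;> simp [h, ih]

theorem orderedProd_congr {k : ℕ} {g h : Index n → G} (H : ∀ x, k ≤ wt x → g x = h x) :
    orderedProd k g = orderedProd k h := by
  rw [orderedProd, orderedProd, List.map_congr_left]
  intro x hx
  exact H x (by simpa using (List.mem_filter.1 hx).2)

theorem orderedProd_mem {k : ℕ} {g : Index n → G} {H : Subgroup G}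
    (hg : ∀ x, k ≤ wt x → g x ∈ H) : orderedProd k g ∈ H := by
  refine Subgroup.list_prod_mem _ fun y hy => ?_
  obtain ⟨x, hx, rfl⟩ := List.mem_map.1 hy
  exact hg x (by simpa using (List.mem_filter.1 hx).2)

theorem map_orderedProd {H : Type*} [Group H] (φ : G →* H) (k : ℕ) (g : Index n → G) :
    φ (orderedProd k g) = orderedProd k fun x => φ (g x) := by
  simp [orderedProd, map_list_prod, Function.comp_def]

/-- Splitting off the factors of the lowest weight; the layer `i` has weight `i + 1`. -/
theorem orderedProd_succ (i : Fin c) (g : Index n → G) :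
    orderedProd (i.val + 1) g =
      (List.ofFn fun j => g ⟨i, j⟩).prod * orderedProd (i.val + 2) g := by
  have key (l : List (Fin c)) (hl : l.Pairwise (· < ·)) (hi : i ∈ l) :
      (((l.flatMap fun i => (List.finRange (n i)).map fun j => (⟨i, j⟩ : Index n)).filter
        fun x => i.val + 1 ≤ wt x).map g).prod =
      (List.ofFn fun j => g ⟨i, j⟩).prod *
      (((l.flatMap fun i => (List.finRange (n i)).map fun j => (⟨i, j⟩ : Index n)).filter
        fun x => i.val + 2 ≤ wt x).map g).prod := by
    induction l with
    | nil => simp at hi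
    | cons a l ih =>
      rw [List.pairwise_cons] at hl
      simp only [List.flatMap_cons, List.filter_append, List.map_append, List.prod_append]
      rcases List.mem_cons.1 hi with rfl | hi
      · have h1 : ((List.finRange (n i)).map fun j => (⟨i, j⟩ : Index n)).filter
            (fun x => i.val + 1 ≤ wt x) = (List.finRange (n i)).map fun j => (⟨i, j⟩ : Index n) :=
          List.filter_eq_self.2 (by simp [wt])
        have h2 : ((List.finRange (n i)).map fun j => (⟨i, j⟩ : Index n)).filter
            (fun x => i.val + 2 ≤ wt x) = [] :=
          List.filter_eq_nil_iff.2 (by simp [wt])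
        have h3 : (l.flatMap fun i => (List.finRange (n i)).map fun j => (⟨i, j⟩ : Index n)).filter
            (fun x => i.val + 1 ≤ wt x) =
            (l.flatMap fun i => (List.finRange (n i)).map fun j => (⟨i, j⟩ : Index n)).filter
            (fun x => i.val + 2 ≤ wt x) := by
          refine List.filter_congr fun x hx => ?_
          obtain ⟨b, hb, hx⟩ := List.mem_flatMap.1 hx
          obtain ⟨j, _, rfl⟩ := List.mem_map.1 hx
          have hib : i.val < b.val := hl.1 b hb
          exact decide_eq_decide.2 (by simp only [wt]; omega)
        rw [h1, h2, h3, List.ofFn_eq_map]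
        simp [Function.comp_def]
      · have hai : a.val < i.val := hl.1 i hi
        have h1 (m : ℕ) (hm : i.val + 1 ≤ m) :
            ((List.finRange (n a)).map fun j => (⟨a, j⟩ : Index n)).filter
            (fun x => m ≤ wt x) = [] :=
          List.filter_eq_nil_iff.2 fun x hx => by
            obtain ⟨j, _, rfl⟩ := List.mem_map.1 hx
            intro h
            have : m ≤ a.val + 1 := of_decide_eq_true h
            omega
        rw [h1 _ le_rfl, h1 _ (by omega), ih hl.2 hi]
        simp
  exact key _ (List.pairwise_lt_finRange c) (List.mem_finRange i)

end Indices

section LowerCentralSeries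

variable {G : Type*} [Group G]

/-- The three subgroups lemma modulo a normal subgroup. -/
theorem commutator_commutator_le_of_rotate {A B C N : Subgroup G} [N.Normal]
    (h1 : ⁅⁅B, C⁆, A⁆ ≤ N) (h2 : ⁅⁅C, A⁆, B⁆ ≤ N) : ⁅⁅A, B⁆, C⁆ ≤ N := by
  have h (K : Subgroup G) : K ≤ N ↔ K.map (QuotientGroup.mk' N) = ⊥ := by
    rw [Subgroup.map_eq_bot_iff, QuotientGroup.ker_mk']
  rw [h] at h1 h2 ⊢
  simp only [Subgroup.map_commutator] at h1 h2 ⊢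
  exact Subgroup.commutator_commutator_eq_bot_of_rotate h1 h2

/-- With `i = m + 1` and `j = n + 1` this is `[Γᵢ, Γⱼ] ≤ Γᵢ₊ⱼ` in the numbering from `1`. -/
theorem commutator_lowerCentralSeries_le (m n : ℕ) :
    ⁅(⊤ : Subgroup G).lowerCentralSeries m, (⊤ : Subgroup G).lowerCentralSeries n⁆ ≤
      (⊤ : Subgroup G).lowerCentralSeries (m + n + 1) := by
  induction n generalizing m with
  | zero => exact le_rfl
  | succ n ih =>
    rw [Subgroup.commutator_comm, Subgroup.lowerCentralSeries_succ _ n]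
    refine commutator_commutator_le_of_rotate ?_ ?_
    · rw [Subgroup.commutator_comm ⊤]
      exact (ih (m + 1)).trans_eq (by congr 1; omega)
    · exact Subgroup.commutator_mono (ih m) le_rfl

theorem comm_mem_Gam {i j : ℕ} (hi : 1 ≤ i) (hj : 1 ≤ j) {x y : G} (hx : x ∈ Gam G i)
    (hy : y ∈ Gam G j) : comm x y ∈ Gam G (i + j) := by
  have h := commutator_lowerCentralSeries_le (G := G) _ _
    (Subgroup.commutator_mem_commutator (inv_mem hx) (inv_mem hy))
  rw [commutatorElement_def, inv_inv, inv_inv] at h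
  rwa [show i - 1 + (j - 1) + 1 = i + j - 1 by omega] at h

theorem Gam_antitone : Antitone (Gam G) := fun _ _ h =>
  Subgroup.lowerCentralSeries_antitone _ (Nat.sub_le_sub_right h 1)

theorem Gam_freeNilpotent (r c : ℕ) : Gam (FreeNilpotent r c) (c + 1) = ⊥ := by
  have h := Subgroup.map_lowerCentralSeries (⊤ : Subgroup (FreeGroup (Fin r)))
    (QuotientGroup.mk' (Gam (FreeGroup (Fin r)) (c + 1))) c
  rw [Subgroup.map_top_of_surjective _ (QuotientGroup.mk'_surjective _)] at h
  change (⊤ : Subgroup (FreeNilpotent r c)).lowerCentralSeries c = ⊥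
  rw [← h, Subgroup.map_eq_bot_iff, QuotientGroup.ker_mk']
  exact le_rfl

end LowerCentralSeries

namespace HallBasicSequence

variable {r c : ℕ} (U : HallBasicSequence r c)

theorem orderedProd_mem_Gam (k : ℕ) (a : Index U.n → ℤ) :
    orderedProd k (fun x => U.u x ^ a x) ∈ Gam (FreeNilpotent r c) k :=
  orderedProd_mem fun x hx => Gam_antitone hx (zpow_mem (U.mem x) _)

theorem exists_eq_orderedProd {k : ℕ} (hk : 1 ≤ k) {g : FreeNilpotent r c}
    (hg : g ∈ Gam (FreeNilpotent r c) k) :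
    ∃ a : Index U.n → ℤ, g = orderedProd k fun x => U.u x ^ a x := by
  induction hd : c + 1 - k generalizing k g with
  | zero =>
    have h := Gam_antitone (show c + 1 ≤ k by omega) hg
    rw [Gam_freeNilpotent, Subgroup.mem_bot] at h
    exact ⟨0, by simp [h, orderedProd]⟩
  | succ d ih =>
    obtain ⟨i, rfl⟩ : ∃ i : Fin c, i.val + 1 = k := ⟨⟨k - 1, by omega⟩, by simp; omega⟩
    obtain ⟨a, ha, -⟩ := U.free i g hg
    obtain ⟨b, hb⟩ := ih (by omega) ha (by omega)
    refine ⟨fun x => if h : x.1 = i then a (h ▸ x.2) else b x, ?_⟩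
    rw [orderedProd_succ, orderedProd_congr (h := fun x => U.u x ^ b x), ← hb]
    · simp
    · intro x hx
      have hxi : x.1 ≠ i := by rintro rfl; simp [wt] at hx
      simp [hxi]

/-- The exponents of an element are unique, weight by weight. -/
theorem word_injective : Function.Injective U.word := by
  have key (k : ℕ) (hk : 1 ≤ k) (a b : Index U.n → ℤ)
      (h : orderedProd k (fun x => U.u x ^ a x) = orderedProd k (fun x => U.u x ^ b x)) :
      ∀ x, k ≤ wt x → a x = b x := by
    induction hd : c + 1 - k generalizing k with
    | zero => intro x hx; have := wt_le x; omega
    | succ d ih =>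
      obtain ⟨i, rfl⟩ : ∃ i : Fin c, i.val + 1 = k := ⟨⟨k - 1, by omega⟩, by simp; omega⟩
      have hab : (fun j => a ⟨i, j⟩) = fun j => b ⟨i, j⟩ := by
        refine (U.free i _ (U.orderedProd_mem_Gam _ a)).unique ?_ ?_
        · rw [orderedProd_succ, inv_mul_cancel_left]
          exact U.orderedProd_mem_Gam _ a
        · rw [h, orderedProd_succ, inv_mul_cancel_left]
          exact U.orderedProd_mem_Gam _ b
      have hab' (j) : a ⟨i, j⟩ = b ⟨i, j⟩ := congrFun hab j
      rw [orderedProd_succ, orderedProd_succ] at h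
      simp only [hab'] at h
      intro x hx
      rcases hx.eq_or_lt with hx | hx
      · obtain ⟨i', j⟩ := x
        obtain rfl : i = i' := Fin.ext (Nat.succ_injective hx)
        exact hab' j
      · exact ih _ (by omega) (mul_left_cancel h) (by omega) x hx
  exact fun a b h => funext fun x => key 1 le_rfl a b h x (Nat.succ_pos _)

theorem orderedProd_eq_word (k : ℕ) (a : Index U.n → ℤ) :
    orderedProd k (fun x => U.u x ^ a x) = U.word fun x => if k ≤ wt x then a x else 0 := by
  rw [orderedProd_eq_ite, word]
  exact orderedProd_congr fun x _ => by split <;> simp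

/-- The Hall basic sequence is a central sequence: by weight, the commutator of `u_y` and `u_x` is a
product of powers of elements that come after both. -/
theorem commutator_mem_closure (x : Index U.n) (N : List (Index U.n))
    (hxN : x :: N <:+ indices U.n) (y : Index U.n) (M : List (Index U.n)) (hM : y :: M <:+ N) :
    (U.u y)⁻¹ * (U.u x)⁻¹ * U.u y * U.u x ∈ Subgroup.closure (U.u '' {z | z ∈ M}) := by
  obtain ⟨e, he⟩ := U.exists_eq_orderedProd (k := wt y + wt x) (by simp only [wt]; omega)
    (comm_mem_Gam (Nat.succ_pos _) (Nat.succ_pos _) (U.mem y) (U.mem x))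
  rw [comm] at he
  rw [he]
  refine orderedProd_mem fun z hz =>
    zpow_mem (Subgroup.subset_closure (Set.mem_image_of_mem U.u ?_)) _
  exact mem_of_cons_suffix_indices (hM.trans ((List.suffix_cons x N).trans hxN))
    (by simp only [wt] at hz ⊢; omega)

theorem exists_word_eval {σ : Type} {F : (σ → ℤ) → FreeNilpotent r c}
    (hF : F ∈ polyMaps U.u (indices U.n) σ) :
    ∃ p : Index U.n → NumPoly σ, ∀ s, F s = U.word fun x => (p x).eval s := by
  obtain ⟨p, hp⟩ := exists_numerical_exponents nodup_indices U.commutator_mem_closure hF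
  exact ⟨p, fun s => by rw [hp, word, orderedProd_one]⟩

theorem word_mem_polyMaps {σ : Type} {a : (σ → ℤ) → Index U.n → ℤ}
    (ha : ∀ x, IsNumerical fun s => a s x) :
    (fun s => U.word (a s)) ∈ polyMaps U.u (indices U.n) σ := by
  have h := prod_map_mem_genSub (numPow U.u σ) (indices U.n) fun x => ⟨_, ha x⟩
  convert h using 1
  funext s
  rw [word, orderedProd_one, Pi.list_prod_apply, List.map_map]
  rfl

theorem nonempty_canonicalPolynomials : Nonempty (CanonicalPolynomials U) := by
  have hmul := U.exists_word_eval (mul_mem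
    (U.word_mem_polyMaps (a := fun (s : Index U.n ⊕ Index U.n → ℤ) x => s (.inl x))
      fun x => isNumerical_var _)
    (U.word_mem_polyMaps (a := fun s x => s (.inr x)) fun x => isNumerical_var _))
  have hpow := U.exists_word_eval
    ((closedUnderSummation U.commutator_mem_closure _ List.suffix_rfl).zpow
      (U.word_mem_polyMaps (a := fun (s : Index U.n ⊕ Unit → ℤ) x => s (.inl x))
        fun x => isNumerical_var _) (isNumerical_var (.inr ())))
  have hcom (x y : Index U.n) := by
    have hx := pow_mem_polyMaps U.u (mem_indices x) (isNumerical_var (0 : Fin 2))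
    have hy := pow_mem_polyMaps U.u (mem_indices y) (isNumerical_var (1 : Fin 2))
    exact U.exists_word_eval (mul_mem (mul_mem (mul_mem (inv_mem hx) (inv_mem hy)) hx) hy)
  choose mul hmul using hmul
  choose pow hpow using hpow
  choose com hcom using hcom
  refine ⟨⟨mul, pow, com, fun a b => hmul (Sum.elim a b),
    fun a l => hpow (Sum.elim a fun _ => l), fun x y a b => ?_⟩⟩
  have h1 : comm (U.u x ^ a) (U.u y ^ b) = U.word fun z => (com x y z).eval ![a, b] :=
    hcom x y ![a, b]
  -- The commutator has an expression of weight at least `wt x + wt y`; it is the same one.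
  obtain ⟨e, he⟩ := U.exists_eq_orderedProd (Nat.le_add_right_of_le (Nat.succ_pos _))
    (comm_mem_Gam (Nat.succ_pos _) (Nat.succ_pos _) (zpow_mem (U.mem x) a) (zpow_mem (U.mem y) b))
  have h2 := U.word_injective (h1.symm.trans (he.trans (U.orderedProd_eq_word _ e)))
  rw [he]
  exact orderedProd_congr fun z hz => by rw [congrFun h2 z, if_pos hz]

end HallBasicSequence

/-- Central factors can be moved to the end of a product. -/
theorem prod_map_mul_of_mem_center {ι G : Type*} [Group G] (L : List ι) (g : ι → G)
    {h : ι → G} (hh : ∀ x, h x ∈ Subgroup.center G) :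
    (L.map fun x => g x * h x).prod = (L.map g).prod * (L.map h).prod := by
  induction L with
  | nil => simp
  | cons x L ih =>
    simp only [List.map_cons, List.prod_cons, ih]
    have := Subgroup.mem_center_iff.1 (hh x) (L.map g).prod
    simp only [mul_assoc]
    rw [← mul_assoc (h x), ← this]
    simp only [mul_assoc]

/-! ### Transfer of polynomial identities to binomial domains -/

section Transfer

universe v
variable {σ : Type*} {R : Type v} [CommRing R]

/-- The functions `φ` on `ℤ^σ` and `ψ` on `R^σ` are given by the same polynomial with rational
coefficients, where the values of `ψ` are compared in fields of characteristic `0` receiving `R`. -/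
def SamePolynomial (φ : (σ → ℤ) → ℤ) (ψ : (σ → R) → R) : Prop :=
  ∃ Q : MvPolynomial σ ℚ, (∀ s, (φ s : ℚ) = Q.eval fun i => (s i : ℚ)) ∧
    ∀ (K : Type v) [Field K] [CharZero K] (j : R →+* K) (v : σ → R),
      j (ψ v) = Q.aeval fun i => j (v i)

namespace SamePolynomial

theorem var (i : σ) : SamePolynomial (fun s => s i) fun v : σ → R => v i :=
  ⟨.X i, by simp, by simp⟩

theorem intCast (z : ℤ) : SamePolynomial (fun _ : σ → ℤ => z) fun _ : σ → R => (z : R) :=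
  ⟨.C z, by simp, by simp⟩

theorem zero : SamePolynomial (fun _ : σ → ℤ => 0) fun _ : σ → R => 0 := by
  simpa using intCast (R := R) (σ := σ) 0

theorem add {φ φ' : (σ → ℤ) → ℤ} {ψ ψ' : (σ → R) → R} (h : SamePolynomial φ ψ)
    (h' : SamePolynomial φ' ψ') :
    SamePolynomial (fun s => φ s + φ' s) fun v => ψ v + ψ' v := by
  obtain ⟨Q, h1, h2⟩ := h
  obtain ⟨Q', h1', h2'⟩ := h'
  exact ⟨Q + Q', fun s => by simp [h1, h1'], fun K _ _ j v => by simp [h2, h2']⟩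

theorem eval [BinomialRing R] {τ : Type*} (p : NumPoly τ) {φ : (σ → ℤ) → τ → ℤ}
    {ψ : (σ → R) → τ → R} (h : ∀ i, SamePolynomial (fun s => φ s i) fun v => ψ v i) :
    SamePolynomial (fun s => p.eval (φ s)) fun v => p.eval (ψ v) := by
  choose Q hQ hQ' using h
  refine ⟨p.eval Q, fun s => ?_, fun K _ _ j v => ?_⟩
  · rw [NumPoly.map_eval, ← eq_intCast (Int.castRingHom ℚ), NumPoly.map_eval]
    simp [hQ]
  · rw [NumPoly.map_eval, ← AlgHom.coe_toRingHom, NumPoly.map_eval]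
    simp [hQ']

/-- A polynomial identity that holds over `ℤ` holds over every binomial domain, since a polynomial
over `ℚ` is determined by its values at integer points and a binomial domain embeds into a field of
characteristic `0`. -/
theorem transfer [IsDomain R] [BinomialRing R] {φ φ' : (σ → ℤ) → ℤ} {ψ ψ' : (σ → R) → R}
    (h : SamePolynomial φ ψ) (h' : SamePolynomial φ' ψ') (heq : ∀ s, φ s = φ' s) (v : σ → R) :
    ψ v = ψ' v := by
  obtain ⟨Q, h1, h2⟩ := h
  obtain ⟨Q', h1', h2'⟩ := h'
  have hQ : Q = Q' := by
    refine MvPolynomial.funext_set (fun _ => Set.range ((↑) : ℤ → ℚ))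
      (fun _ => Set.infinite_range_of_injective Int.cast_injective) fun x hx => ?_
    choose s hs using fun i => hx i (Set.mem_univ i)
    obtain rfl : (fun i => (s i : ℚ)) = x := funext hs
    rw [← h1, ← h1', heq]
  have := BinomialRing.toIsAddTorsionFree (R := R)
  have := CharZero.of_isAddTorsionFree R R
  have : CharZero (FractionRing R) := inferInstance
  apply IsFractionRing.injective R (FractionRing R)
  rw [h2, h2', hQ]

end SamePolynomial

end Transfer

/-! ### Identities between the canonical polynomials -/

/-- The tuple that agrees with `a` on the list `L` and vanishes elsewhere. -/
def restrict {ι A : Type*} [DecidableEq ι] [Zero A] (L : List ι) (a : ι → A) : ι → A :=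
  fun x => if x ∈ L then a x else 0

/-- The tuple that agrees with `a` in weights at least `k` and vanishes in smaller weights. -/
def truncate {c : ℕ} {n : Fin c → ℕ} {A : Type*} [Zero A] (k : ℕ) (a : Index n → A) : Index n → A :=
  fun x => if k ≤ wt x then a x else 0

namespace HallBasicSequence

variable {r c : ℕ} (U : HallBasicSequence r c)

theorem word_zero : U.word 0 = 1 := by
  simp [word, orderedProd]

theorem word_restrict {L : List (Index U.n)} (hL : L <:+ indices U.n) (a : Index U.n → ℤ) :
    U.word (restrict L a) = (L.map fun x => U.u x ^ a x).prod := by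
  obtain ⟨K, hK⟩ := hL
  have hnd := nodup_indices (n := U.n)
  rw [← hK] at hnd
  rw [word, orderedProd_one, ← hK, List.map_append, List.prod_append, List.prod_eq_one, one_mul]
  · congr 1
    exact List.map_congr_left fun x hx => by simp [restrict, hx]
  · intro y hy
    obtain ⟨x, hx, rfl⟩ := List.mem_map.1 hy
    have hx' : x ∉ L := fun h => (List.nodup_append.1 hnd).2.2 x hx x h rfl
    simp [restrict, hx']

theorem word_single (x : Index U.n) (b : ℤ) : U.word (Pi.single x b) = U.u x ^ b := by
  have key (L : List (Index U.n)) (hL : L.Nodup) :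
      (L.map fun y => U.u y ^ (Pi.single x b : Index U.n → ℤ) y).prod =
        if x ∈ L then U.u x ^ b else 1 := by
    induction L with
    | nil => simp
    | cons y L ih =>
      rw [List.nodup_cons] at hL
      rw [List.map_cons, List.prod_cons, ih hL.2]
      by_cases h : y = x
      · subst h; simp [hL.1]
      · simp [h, Ne.symm h]
  rw [word, orderedProd_one, key _ nodup_indices, if_pos (mem_indices x)]

theorem word_truncate (k : ℕ) (a : Index U.n → ℤ) :
    U.word (truncate k a) = orderedProd k fun x => U.u x ^ a x :=
  (U.orderedProd_eq_word k a).symm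

theorem mem_center_of_wt_eq {x : Index U.n} (hx : wt x = c) :
    U.u x ∈ Subgroup.center (FreeNilpotent r c) := by
  rw [Subgroup.mem_center_iff]
  intro g
  have h := comm_mem_Gam (i := wt x) (j := 1) (Nat.succ_pos _) le_rfl (U.mem x) (Subgroup.mem_top g)
  rw [hx, Gam_freeNilpotent, Subgroup.mem_bot, comm, mul_assoc, mul_assoc,
    inv_mul_eq_one, eq_inv_mul_iff_mul_eq] at h
  exact h

theorem word_extendTop_mem_center (v : Layer U.n c → ℤ) :
    U.word (extendTop v) ∈ Subgroup.center (FreeNilpotent r c) := by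
  refine orderedProd_mem fun x _ => ?_
  unfold extendTop
  split_ifs with hx
  · exact zpow_mem (U.mem_center_of_wt_eq hx) _
  · simp

theorem word_add_extendTop (a : Index U.n → ℤ) (v : Layer U.n c → ℤ) :
    U.word (a + extendTop v) = U.word a * U.word (extendTop v) := by
  simp only [word, orderedProd_one, Pi.add_apply, zpow_add]
  refine prod_map_mul_of_mem_center _ _ fun x => ?_
  unfold extendTop
  split_ifs with hx
  · exact zpow_mem (U.mem_center_of_wt_eq hx) _
  · simp

/-- Modulo `Γ₂` the exponents of weight one add up when words are multiplied. -/
theorem eq_add_of_word_eq_mul {a b d : Index U.n → ℤ} (h : U.word d = U.word a * U.word b)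
    {x : Index U.n} (hx : wt x = 1) : d x = a x + b x := by
  have hmem : (U.word (a + b))⁻¹ * U.word d ∈ Gam (FreeNilpotent r c) 2 := by
    change _ ∈ _root_.commutator (FreeNilpotent r c)
    rw [← Abelianization.ker_of, MonoidHom.mem_ker, map_mul, map_inv, inv_mul_eq_one, h, map_mul]
    simp only [word, map_orderedProd, Pi.add_apply, zpow_add, map_mul]
    simp only [orderedProd_one, List.prod_map_mul]
  obtain ⟨i, j⟩ := x
  obtain ⟨i, hi⟩ := i
  obtain rfl : i = 0 := by simpa [wt] using hx
  have hs (e : Index U.n → ℤ) := orderedProd_succ ⟨0, hi⟩ fun x => U.u x ^ e x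
  have := (U.free ⟨0, hi⟩ (U.word d) (Subgroup.mem_top _)).unique
    (y₁ := fun j => d ⟨⟨0, hi⟩, j⟩) (y₂ := fun j => (a + b) ⟨⟨0, hi⟩, j⟩) ?_ ?_
  · exact congrFun this j
  · rw [word, hs d, inv_mul_cancel_left]
    exact U.orderedProd_mem_Gam 2 d
  -- The factors of weight at least two in `word (a + b)` lie in `Γ₂`.
  · rw [← mul_mem_cancel_left (inv_mem (U.orderedProd_mem_Gam 2 (a + b))), ← mul_assoc,
      ← mul_inv_rev]
    rw [word, hs (a + b)] at hmem
    exact hmem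

end HallBasicSequence

section Tuples

universe v
variable {σ τ : Type*} {R : Type v} [CommRing R]

/-- The tuples `φ` of functions on `ℤ^σ` and `ψ` of functions on `R^σ` are given by the same tuple
of polynomials. -/
def SameTuple (φ : (σ → ℤ) → τ → ℤ) (ψ : (σ → R) → τ → R) : Prop :=
  ∀ x, SamePolynomial (fun s => φ s x) fun v => ψ v x

namespace SameTuple

theorem proj (g : τ → σ) : SameTuple (fun s x => s (g x)) fun (v : σ → R) x => v (g x) :=
  fun x => .var (g x)

theorem zero : SameTuple (fun (_ : σ → ℤ) (_ : τ) => 0) fun (_ : σ → R) _ => 0 := fun _ => .zero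

theorem add {φ φ' : (σ → ℤ) → τ → ℤ} {ψ ψ' : (σ → R) → τ → R} (h : SameTuple φ ψ)
    (h' : SameTuple φ' ψ') : SameTuple (fun s => φ s + φ' s) fun v => ψ v + ψ' v :=
  fun x => (h x).add (h' x)

theorem single [DecidableEq τ] (x : τ) {φ : (σ → ℤ) → ℤ} {ψ : (σ → R) → R}
    (h : SamePolynomial φ ψ) :
    SameTuple (fun s => Pi.single x (φ s)) fun v => Pi.single x (ψ v) := by
  intro y
  by_cases hy : y = x
  · subst hy; simpa using h
  · simpa [hy] using SamePolynomial.zero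

theorem restrict [DecidableEq τ] (L : List τ) {φ : (σ → ℤ) → τ → ℤ} {ψ : (σ → R) → τ → R}
    (h : SameTuple φ ψ) :
    SameTuple (fun s => restrict L (φ s)) fun v => HallCompletion.restrict L (ψ v) := by
  intro y
  by_cases hy : y ∈ L
  · simpa [HallCompletion.restrict, hy] using h y
  · simpa [HallCompletion.restrict, hy] using SamePolynomial.zero

theorem truncate {c : ℕ} {n : Fin c → ℕ} (k : ℕ) {φ : (σ → ℤ) → Index n → ℤ}
    {ψ : (σ → R) → Index n → R} (h : SameTuple φ ψ) :
    SameTuple (fun s => truncate k (φ s)) fun v => HallCompletion.truncate k (ψ v) := by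
  intro y
  by_cases hy : k ≤ wt y
  · simpa [HallCompletion.truncate, hy] using h y
  · simpa [HallCompletion.truncate, hy] using SamePolynomial.zero

theorem extendTop {c : ℕ} {n : Fin c → ℕ} {φ : (σ → ℤ) → Layer n c → ℤ}
    {ψ : (σ → R) → Layer n c → R} (h : SameTuple φ ψ) :
    SameTuple (fun s => extendTop (φ s)) fun v => HallCompletion.extendTop (ψ v) := by
  intro y
  by_cases hy : wt y = c
  · simpa [HallCompletion.extendTop, hy] using h ⟨y, hy⟩
  · simpa [HallCompletion.extendTop, hy] using SamePolynomial.zero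

theorem elim {τ' : Type*} {φ : (σ → ℤ) → τ → ℤ} {ψ : (σ → R) → τ → R} {φ' : (σ → ℤ) → τ' → ℤ}
    {ψ' : (σ → R) → τ' → R} (h : SameTuple φ ψ) (h' : SameTuple φ' ψ') :
    SameTuple (fun s => Sum.elim (φ s) (φ' s)) fun v => Sum.elim (ψ v) (ψ' v) := by
  rintro (x | x)
  exacts [h x, h' x]

variable [BinomialRing R]

theorem eval {ρ : Type*} (p : ρ → NumPoly τ) {φ : (σ → ℤ) → τ → ℤ} {ψ : (σ → R) → τ → R}
    (h : SameTuple φ ψ) :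
    SameTuple (fun s x => (p x).eval (φ s)) fun v x => (p x).eval (ψ v) :=
  fun x => .eval (p x) h

theorem transfer [IsDomain R] {φ φ' : (σ → ℤ) → τ → ℤ} {ψ ψ' : (σ → R) → τ → R}
    (h : SameTuple φ ψ) (h' : SameTuple φ' ψ') (heq : ∀ s, φ s = φ' s) (v : σ → R) :
    ψ v = ψ' v :=
  funext fun x => (h x).transfer (h' x) (fun s => congrFun (heq s) x) v

end SameTuple

end Tuples

section ExtendTop

variable {c : ℕ} {n : Fin c → ℕ} {R : Type*} [CommRing R]

theorem extendTop_of_ne (v : Layer n c → R) {x : Index n} (h : wt x ≠ c) : extendTop v x = 0 :=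
  dif_neg h

theorem extendTop_add (v w : Layer n c → R) :
    extendTop (v + w) = extendTop v + extendTop w := by
  funext x
  by_cases h : wt x = c <;> simp [extendTop, h]

theorem extendTop_neg (v : Layer n c → R) : extendTop (-v) = -extendTop v := by
  funext x
  by_cases h : wt x = c <;> simp [extendTop, h]

theorem extendTop_zero : extendTop (0 : Layer n c → R) = 0 := by
  funext x
  by_cases h : wt x = c <;> simp [extendTop, h]

theorem truncate_extendTop (v : Layer n c → R) : truncate c (extendTop v) = extendTop v := by
  funext x
  by_cases h : c ≤ wt x
  · simp [truncate, h]
  · simp [truncate, h, extendTop, show wt x ≠ c by omega]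

end ExtendTop

section TupleMul

variable {r c : ℕ} {U : HallBasicSequence r c} (P : CanonicalPolynomials U)

/-- The product `p(𝐚, 𝐛)` of tuples of exponents, without the contribution of the cocycles. -/
noncomputable def tupleMul {R : Type*} [CommRing R] [BinomialRing R] (a b : Index U.n → R) :
    Index U.n → R :=
  fun x => (P.mul x).eval (Sum.elim a b)

theorem SameTuple.mul {σ R : Type*} [CommRing R] [BinomialRing R]
    {φ φ' : (σ → ℤ) → Index U.n → ℤ} {ψ ψ' : (σ → R) → Index U.n → R}
    (h : SameTuple φ ψ) (h' : SameTuple φ' ψ') :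
    SameTuple (fun s => tupleMul P (φ s) (φ' s)) fun v => tupleMul P (ψ v) (ψ' v) :=
  (h.elim h').eval P.mul

theorem word_tupleMul (a b : Index U.n → ℤ) :
    U.word (tupleMul P a b) = U.word a * U.word b :=
  (P.mul_spec a b).symm

variable {R : Type*} [CommRing R] [IsDomain R] [BinomialRing R]

theorem tupleMul_assoc (a b d : Index U.n → R) :
    tupleMul P (tupleMul P a b) d = tupleMul P a (tupleMul P b d) :=
  have A : SameTuple (R := R) _ _ :=
    .proj fun x : Index U.n => Sum.inl (β := Index U.n ⊕ Index U.n) x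
  have B : SameTuple (R := R) _ _ :=
    .proj fun x : Index U.n => Sum.inr (α := Index U.n) (Sum.inl (β := Index U.n) x)
  have D : SameTuple (R := R) _ _ :=
    .proj fun x : Index U.n => Sum.inr (α := Index U.n) (Sum.inr (α := Index U.n) x)
  ((A.mul P B).mul P D).transfer (A.mul P (B.mul P D))
    (fun s => U.word_injective (by simp only [word_tupleMul, mul_assoc]))
    (Sum.elim a (Sum.elim b d))

theorem tupleMul_zero (a : Index U.n → R) : tupleMul P a 0 = a :=
  have A : SameTuple (R := R) _ _ := .proj fun x : Index U.n => x
  (A.mul P .zero).transfer A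
    (fun s => U.word_injective (by rw [word_tupleMul]; exact mul_eq_left.2 U.word_zero)) a

theorem zero_tupleMul (a : Index U.n → R) : tupleMul P 0 a = a :=
  have A : SameTuple (R := R) _ _ := .proj fun x : Index U.n => x
  (SameTuple.zero.mul P A).transfer A
    (fun s => U.word_injective (by rw [word_tupleMul]; exact mul_eq_right.2 U.word_zero)) a

theorem tupleMul_apply_of_wt_eq_one (a b : Index U.n → R) {x : Index U.n} (hx : wt x = 1) :
    tupleMul P a b x = a x + b x :=
  have A : SameTuple (R := R) _ _ := .proj fun x : Index U.n => Sum.inl (β := Index U.n) x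
  have B : SameTuple (R := R) _ _ := .proj fun x : Index U.n => Sum.inr (α := Index U.n) x
  ((A.mul P B) x).transfer ((A.add B) x)
    (fun _ => U.eq_add_of_word_eq_mul (word_tupleMul P _ _) hx) (Sum.elim a b)

theorem add_extendTop_tupleMul (a b : Index U.n → R) (v : Layer U.n c → R) :
    tupleMul P (a + extendTop v) b = tupleMul P a b + extendTop v :=
  have A : SameTuple (R := R) _ _ :=
    .proj fun x : Index U.n => Sum.inl (β := Index U.n ⊕ Layer U.n c) x
  have B : SameTuple (R := R) _ _ :=
    .proj fun x : Index U.n => Sum.inr (α := Index U.n) (Sum.inl (β := Layer U.n c) x)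
  have V : SameTuple (R := R) _ _ :=
    .proj fun x : Layer U.n c => Sum.inr (α := Index U.n) (Sum.inr (α := Index U.n) x)
  ((A.add V.extendTop).mul P B).transfer ((A.mul P B).add V.extendTop)
    (fun s => U.word_injective (by
      rw [word_tupleMul, U.word_add_extendTop, U.word_add_extendTop, word_tupleMul, mul_assoc,
        mul_assoc, Subgroup.mem_center_iff.1 (U.word_extendTop_mem_center _)]))
    (Sum.elim a (Sum.elim b v))

theorem tupleMul_add_extendTop (a b : Index U.n → R) (v : Layer U.n c → R) :
    tupleMul P a (b + extendTop v) = tupleMul P a b + extendTop v :=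
  have A : SameTuple (R := R) _ _ :=
    .proj fun x : Index U.n => Sum.inl (β := Index U.n ⊕ Layer U.n c) x
  have B : SameTuple (R := R) _ _ :=
    .proj fun x : Index U.n => Sum.inr (α := Index U.n) (Sum.inl (β := Layer U.n c) x)
  have V : SameTuple (R := R) _ _ :=
    .proj fun x : Layer U.n c => Sum.inr (α := Index U.n) (Sum.inr (α := Index U.n) x)
  (A.mul P (B.add V.extendTop)).transfer ((A.mul P B).add V.extendTop)
    (fun s => U.word_injective (by
      rw [word_tupleMul, U.word_add_extendTop, U.word_add_extendTop, word_tupleMul, mul_assoc]))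
    (Sum.elim a (Sum.elim b v))

/-- The tuple `q(𝐚, -1)` is inverse to `𝐚` for the product `p`. -/
theorem inv_tupleMul (a : Index U.n → R) :
    tupleMul P (fun x => (P.pow x).eval (Sum.elim a fun _ => -1)) a = 0 := by
  have A : SameTuple (R := R) _ _ := .proj fun x : Index U.n => x
  have M : SameTuple (R := R) (fun _ (_ : Unit) => -1) fun (_ : Index U.n → R) _ => -1 :=
    fun _ => by simpa using SamePolynomial.intCast (-1)
  refine (((A.elim M).eval P.pow).mul P A).transfer .zero (fun s => U.word_injective ?_) a
  rw [word_tupleMul, ← P.pow_spec, zpow_neg_one, inv_mul_cancel]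
  exact U.word_zero.symm

/-- Putting `u_x^a` in front of a word in later elements changes only the exponent at `x`. -/
theorem single_tupleMul_restrict {x : Index U.n} {M : List (Index U.n)}
    (hM : x :: M <:+ indices U.n) (a : Index U.n → R) :
    tupleMul P (Pi.single x (a x)) (restrict M a) = restrict (x :: M) a :=
  have A : SameTuple (R := R) _ _ := .proj fun x : Index U.n => x
  ((SameTuple.single x (A x)).mul P (A.restrict M)).transfer (A.restrict (x :: M))
    (fun s => U.word_injective (by
      rw [word_tupleMul, U.word_single, U.word_restrict hM,
        U.word_restrict ((List.suffix_cons x M).trans hM), List.map_cons, List.prod_cons])) a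

theorem single_tupleMul_single (x : Index U.n) (a b : R) :
    tupleMul P (Pi.single x a) (Pi.single x b) = Pi.single x (a + b) :=
  have A : SamePolynomial (R := R) _ _ := .var (0 : Fin 2)
  have B : SamePolynomial (R := R) _ _ := .var (1 : Fin 2)
  ((SameTuple.single x A).mul P (.single x B)).transfer (.single x (A.add B))
    (fun s => U.word_injective (by
      rw [word_tupleMul, U.word_single, U.word_single, U.word_single, zpow_add])) ![a, b]

/-- The commutator relation in the form `u_x^a u_y^b = u_y^b u_x^a [u_x^a, u_y^b]`. -/
theorem single_tupleMul_single_eq (x y : Index U.n) (a b : R) :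
    tupleMul P (Pi.single x a) (Pi.single y b) =
      tupleMul P (tupleMul P (Pi.single y b) (Pi.single x a))
        (truncate (wt x + wt y) fun z => (P.com x y z).eval ![a, b]) :=
  have A : SamePolynomial (R := R) _ _ := .var (0 : Fin 2)
  have B : SamePolynomial (R := R) _ _ := .var (1 : Fin 2)
  have T : SameTuple (R := R) _ _ := .eval (P.com x y) (.proj fun i : Fin 2 => i)
  ((SameTuple.single x A).mul P (.single y B)).transfer
    (((SameTuple.single y B).mul P (.single x A)).mul P (T.truncate (wt x + wt y)))
    (fun s => U.word_injective (by
      have h := P.com_spec x y (s 0) (s 1)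
      rw [show ![s 0, s 1] = s from (List.ofFn_inj.1 rfl)] at h
      simp only [word_tupleMul, U.word_single, U.word_truncate]
      rw [← h, comm]
      group)) ![a, b]

end TupleMul

/-! ### The deformed group -/

section Twist

variable {r c : ℕ} {U : HallBasicSequence r c} {R : Type*} [CommRing R]

/-- The contribution `∑_k f^k(a_{1k}, b_{1k})` of the cocycles to a product. -/
def twist (f : Layer U.n 1 → SymmetricCocycle R (Layer U.n c → R)) (a b : Index U.n → R) :
    Layer U.n c → R :=
  ∑ k : Layer U.n 1, (f k).toFun (a k) (b k)

variable {f : Layer U.n 1 → SymmetricCocycle R (Layer U.n c → R)}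

theorem twist_congr {a a' b b' : Index U.n → R} (ha : ∀ x, wt x = 1 → a x = a' x)
    (hb : ∀ x, wt x = 1 → b x = b' x) : twist f a b = twist f a' b' :=
  Finset.sum_congr rfl fun k _ => by rw [ha k k.2, hb k k.2]

theorem twist_cocycle (a b d : Index U.n → R) :
    twist f (a + b) d + twist f a b = twist f a (b + d) + twist f b d := by
  simp only [twist, ← Finset.sum_add_distrib]
  exact Finset.sum_congr rfl fun k _ => (f k).cocycle _ _ _

theorem twist_comm (a b : Index U.n → R) : twist f a b = twist f b a :=
  Finset.sum_congr rfl fun k _ => (f k).symm _ _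

theorem twist_eq_zero {a b : Index U.n → R} (h : ∀ x, wt x = 1 → a x = 0 ∨ b x = 0) :
    twist f a b = 0 := by
  refine Finset.sum_eq_zero fun k _ => ?_
  rcases h k k.2 with h | h <;> rw [h]
  exacts [(f k).zero_left _, (f k).zero_right _]

theorem add_extendTop_apply_of_wt_eq_one (hc : 2 ≤ c) (a : Index U.n → R) (v : Layer U.n c → R)
    {x : Index U.n} (hx : wt x = 1) : (a + extendTop v) x = a x := by
  rw [Pi.add_apply, extendTop_of_ne v (by omega), add_zero]

end Twist

section Group

variable {r c : ℕ} {U : HallBasicSequence r c} {R : Type*} [CommRing R] [IsDomain R]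
  [BinomialRing R] {P : CanonicalPolynomials U}
  {f : Layer U.n 1 → SymmetricCocycle R (Layer U.n c → R)}

/-- The group `N_{r,c}(R, f̄)`. The cocycles depend only on the exponents of weight one, which are
additive, and they contribute to the exponents of weight `c`, which are central; this reduces the
group laws to those of the polynomials `p` and `q` and the cocycle identity. -/
noncomputable instance QN.instGroup [Fact (2 ≤ c)] : Group (QN P f) where
  mul := QN.mul
  one := ⟨0⟩
  inv := QN.inv
  mul_assoc g h k := by
    have hc : 2 ≤ c := Fact.out
    refine QN.ext ?_
    change tupleMul P (tupleMul P g.coord h.coord + extendTop (twist f g.coord h.coord)) k.coord +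
      extendTop (twist f (tupleMul P g.coord h.coord + extendTop (twist f g.coord h.coord)) k.coord)
      = tupleMul P g.coord (tupleMul P h.coord k.coord + extendTop (twist f h.coord k.coord)) +
      extendTop (twist f g.coord (tupleMul P h.coord k.coord + extendTop (twist f h.coord k.coord)))
    have hw (a b : Index U.n → R) (v : Layer U.n c → R) (x : Index U.n) (hx : wt x = 1) :
        (tupleMul P a b + extendTop v) x = (a + b) x := by
      rw [add_extendTop_apply_of_wt_eq_one hc _ _ hx, tupleMul_apply_of_wt_eq_one P _ _ hx,
        Pi.add_apply]
    rw [add_extendTop_tupleMul, tupleMul_add_extendTop, tupleMul_assoc,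
      twist_congr (hw _ _ _) fun _ _ => rfl, twist_congr (fun _ _ => rfl) (hw h.coord k.coord _),
      add_assoc, add_assoc, ← extendTop_add, ← extendTop_add, add_comm (twist f g.coord h.coord),
      twist_cocycle, add_comm (twist f h.coord k.coord)]
  one_mul g := by
    refine QN.ext ?_
    change tupleMul P 0 g.coord + extendTop (twist f 0 g.coord) = g.coord
    rw [zero_tupleMul, twist_eq_zero (a := 0) fun _ _ => .inl rfl, extendTop_zero, add_zero]
  mul_one g := by
    refine QN.ext ?_
    change tupleMul P g.coord 0 + extendTop (twist f g.coord 0) = g.coord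
    rw [tupleMul_zero, twist_eq_zero (b := 0) fun _ _ => .inr rfl, extendTop_zero, add_zero]
  inv_mul_cancel g := by
    have hc : 2 ≤ c := Fact.out
    refine QN.ext ?_
    have hi : (QN.inv g).coord = (fun x => (P.pow x).eval (Sum.elim g.coord fun _ => -1)) +
        extendTop (-twist f g.coord (-g.coord)) := by
      rw [extendTop_neg, ← sub_eq_add_neg]
      rfl
    change tupleMul P (QN.inv g).coord g.coord + extendTop (twist f (QN.inv g).coord g.coord) = 0
    have h1 (x : Index U.n) (hx : wt x = 1) : (QN.inv g).coord x = (-g.coord) x := by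
      have := congrFun (inv_tupleMul P g.coord) x
      rw [tupleMul_apply_of_wt_eq_one P _ _ hx] at this
      rw [hi, add_extendTop_apply_of_wt_eq_one hc _ _ hx]
      exact eq_neg_of_add_eq_zero_left this
    rw [twist_congr h1 fun _ _ => rfl, hi, add_extendTop_tupleMul, inv_tupleMul, zero_add,
      extendTop_neg, twist_comm, neg_add_cancel]

namespace QN

variable [Fact (2 ≤ c)]

theorem coord_mul (g h : QN P f) :
    (g * h).coord = tupleMul P g.coord h.coord + extendTop (twist f g.coord h.coord) := rfl

theorem coord_one : (1 : QN P f).coord = 0 := rfl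

theorem coord_mul_of_eq_zero {g h : QN P f}
    (H : ∀ x, wt x = 1 → g.coord x = 0 ∨ h.coord x = 0) :
    (g * h).coord = tupleMul P g.coord h.coord := by
  rw [coord_mul, twist_eq_zero H, extendTop_zero, add_zero]

theorem gen_zero (x : Index U.n) : gen P f x 0 = 1 :=
  QN.ext (Pi.single_zero x)

/-- An ordered product of the `u_x^{a_x}` in `N_{r,c}(R, f̄)` is the formal product: no cocycle
contributes, since each index occurs only once. -/
theorem coord_prod_gen {L : List (Index U.n)} (hL : L <:+ indices U.n) (a : Index U.n → R) :
    (L.map fun x => gen P f x (a x)).prod.coord = restrict L a := by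
  induction L with
  | nil => exact funext fun x => by simp [restrict, coord_one]
  | cons x L ih =>
    have ih := ih ((List.suffix_cons x L).trans hL)
    have hx : x ∉ L := (List.nodup_cons.1 (nodup_indices.sublist hL.sublist)).1
    rw [List.map_cons, List.prod_cons, coord_mul_of_eq_zero, ih]
    · exact single_tupleMul_restrict P hL a
    · intro y _
      by_cases hy : y = x
      · subst hy; right; simp [ih, restrict, hx]
      · left; simp [gen, hy]

theorem orderedProd_gen_coord (g : QN P f) :
    orderedProd 1 (fun x => gen P f x (g.coord x)) = g := by
  refine QN.ext ?_
  rw [orderedProd_one, coord_prod_gen List.suffix_rfl]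
  exact funext fun x => by simp [restrict, mem_indices]

theorem coord_orderedProd_gen (k : ℕ) (a : Index U.n → R) :
    (orderedProd k fun x => gen P f x (a x)).coord = truncate k a := by
  refine Eq.trans ?_ (congrArg coord (orderedProd_gen_coord (P := P) (f := f) ⟨truncate k a⟩))
  rw [orderedProd_eq_ite]
  congr 2
  funext x
  by_cases h : k ≤ wt x <;> simp [truncate, h, gen_zero]

/-- The commutators are those of the undeformed group: the two products `u_x^a u_y^b` and
`u_y^b u_x^a` have the same cocycle contribution by symmetry, and the commutator has weight at
least `2`. -/
theorem comm_gen (x y : Index U.n) (a b : R) : comm (gen P f x a) (gen P f y b) =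
    orderedProd (wt x + wt y) fun z => gen P f z ((P.com x y z).eval ![a, b]) := by
  suffices h : gen P f x a * gen P f y b = gen P f y b * gen P f x a *
      orderedProd (wt x + wt y) fun z => gen P f z ((P.com x y z).eval ![a, b]) by
    rw [comm, mul_assoc, ← mul_inv_rev, h, inv_mul_cancel_left]
  have hc : 2 ≤ c := Fact.out
  refine QN.ext ?_
  rw [coord_mul_of_eq_zero (g := _ * _), coord_orderedProd_gen, coord_mul, coord_mul,
    add_extendTop_tupleMul, twist_comm]
  · exact congrArg (· + _) (single_tupleMul_single_eq P x y a b)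
  · intro z hz
    right
    rw [coord_orderedProd_gen, truncate, if_neg (by rw [hz]; simp only [wt]; omega)]

theorem gen_mul_gen (x : Index U.n) (hx : 2 ≤ wt x) (a b : R) :
    gen P f x a * gen P f x b = gen P f x (a + b) := by
  refine QN.ext ?_
  rw [coord_mul_of_eq_zero]
  · exact single_tupleMul_single P x a b
  · intro y hy
    left
    have : y ≠ x := by rintro rfl; omega
    simp [gen, this]

theorem gen_mul_gen_of_wt_eq_one (j : Layer U.n 1) (a b : R) :
    gen P f j.1 a * gen P f j.1 b = gen P f j.1 (a + b) *
      orderedProd c fun z => gen P f z (extendTop ((f j).toFun a b) z) := by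
  have hc : 2 ≤ c := Fact.out
  refine QN.ext ?_
  have ht : twist f (Pi.single j.1 a) (Pi.single j.1 b) = (f j).toFun a b := by
    rw [twist, Finset.sum_eq_single j]
    · simp
    · intro k _ hk
      rw [Pi.single_eq_of_ne fun h => hk (Subtype.ext h), (f k).zero_left]
    · simp
  rw [coord_mul_of_eq_zero (h := orderedProd _ _), coord_orderedProd_gen, truncate_extendTop]
  · have h := tupleMul_add_extendTop P (Pi.single j.1 (a + b)) 0 ((f j).toFun a b)
    rw [zero_add, tupleMul_zero] at h
    rw [coord_mul]
    change tupleMul P (Pi.single j.1 a) (Pi.single j.1 b) +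
      extendTop (twist f (Pi.single j.1 a) (Pi.single j.1 b)) =
      tupleMul P (Pi.single j.1 (a + b)) (extendTop ((f j).toFun a b))
    rw [h, single_tupleMul_single, ht]
  · intro z hz
    right
    rw [coord_orderedProd_gen, truncate, if_neg (by omega)]

theorem closure_gen : Subgroup.closure
    {g | ∃ (x : Index U.n) (a : R), g = gen P f x a} = ⊤ := by
  refine eq_top_iff.2 fun g _ => ?_
  rw [← orderedProd_gen_coord g]
  exact orderedProd_mem fun x _ => Subgroup.subset_closure ⟨x, _, rfl⟩

end QN

end Group

/-! ### The presentation -/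

section Presentation

variable {r c : ℕ} {U : HallBasicSequence r c} {R : Type*} [CommRing R] [BinomialRing R]

variable (P : CanonicalPolynomials U) (f : Layer U.n 1 → SymmetricCocycle R (Layer U.n c → R))

/-- The group defined by the relations between the symbols `u_x^a`. -/
abbrev Presented : Type _ := PresentedGroup {w | IsRelator P f w}

/-- The symbol `u_x^a` in the presented group. -/
def Presented.gen (x : Index U.n) (a : R) : Presented P f := PresentedGroup.of (x, a)

variable {P f}

namespace Presented

theorem comm_gen (x y : Index U.n) (a b : R) : comm (gen P f x a) (gen P f y b) =
    orderedProd (wt x + wt y) fun z => gen P f z ((P.com x y z).eval ![a, b]) := by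
  have h := PresentedGroup.mk_eq_mk_of_mul_inv_mem (rels := {w | IsRelator P f w})
    (IsRelator.commutator (P := P) (f := f) x y a b)
  rw [map_orderedProd] at h
  exact h

theorem gen_mul_gen {x : Index U.n} (hx : 2 ≤ wt x) (a b : R) :
    gen P f x a * gen P f x b = gen P f x (a + b) :=
  PresentedGroup.mk_eq_mk_of_mul_inv_mem (rels := {w | IsRelator P f w})
    (IsRelator.add (P := P) (f := f) x hx a b)

theorem gen_mul_gen_of_wt_eq_one (j : Layer U.n 1) (a b : R) :
    gen P f j.1 a * gen P f j.1 b = gen P f j.1 (a + b) *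
      orderedProd c fun z => gen P f z (extendTop ((f j).toFun a b) z) := by
  have h := PresentedGroup.mk_eq_mk_of_mul_inv_mem (rels := {w | IsRelator P f w})
    (IsRelator.addOne (P := P) (f := f) j a b)
  rw [map_mul, map_mul, map_orderedProd] at h
  exact h

/-- In weight one the relation `u^0 u^0 = u^0 𝐮_c^{f(0, 0)}` is used, whose last factor is a product
of symbols `u_z^0` of weight `c ≥ 2`. -/
theorem gen_zero (hc : 2 ≤ c) (x : Index U.n) : gen P f x 0 = 1 := by
  have h2 {x : Index U.n} (hx : 2 ≤ wt x) : gen P f x 0 = 1 := by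
    have h := gen_mul_gen (P := P) (f := f) hx 0 0
    rwa [add_zero, mul_eq_left] at h
  by_cases hx : 2 ≤ wt x
  · exact h2 hx
  · have h := gen_mul_gen_of_wt_eq_one (P := P) (f := f)
      ⟨x, by simp only [wt] at hx ⊢; omega⟩ 0 0
    rw [add_zero, mul_right_inj, (f _).zero_left] at h
    rw [h]
    refine Subgroup.mem_bot.1 (orderedProd_mem fun z hz => ?_)
    rw [extendTop_zero, Pi.zero_apply, Subgroup.mem_bot]
    exact h2 (by omega)

/-- The collection process in the presented group: the relations bring every element to the form
`𝐮^𝐚`. -/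
theorem exists_eq_orderedProd (hc : 2 ≤ c) (w : Presented P f) :
    ∃ a : Index U.n → R, w = orderedProd 1 fun x => gen P f x (a x) := by
  have htop : genSub (gen P f) (indices U.n) = ⊤ := by
    rw [eq_top_iff, ← PresentedGroup.closure_range_of, Subgroup.closure_le]
    rintro _ ⟨⟨x, a⟩, rfl⟩
    exact mem_genSub (gen P f) (mem_indices x) a
  simp only [orderedProd_one]
  refine exists_eq_prod_of_mem_genSub nodup_indices ?_ ?_ (htop ▸ Subgroup.mem_top w)
  · intro x M hM y hy a b
    have h : (gen P f x a)⁻¹ * gen P f y b * gen P f x a =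
        gen P f y b * comm (gen P f y b) (gen P f x a) := by
      rw [comm]
      group
    rw [h, comm_gen]
    refine mul_mem (mem_genSub _ hy b) (orderedProd_mem fun z hz => mem_genSub _ ?_ _)
    have := wt_le_of_cons_suffix_indices hM hy
    exact mem_of_cons_suffix_indices hM (by simp only [wt] at this hz ⊢; omega)
  · intro x M hM a b
    by_cases hx : 2 ≤ wt x
    · rw [gen_mul_gen hx, inv_mul_cancel]
      exact one_mem _
    · have hx1 : wt x = 1 := by simp only [wt] at hx ⊢; omega
      rw [gen_mul_gen_of_wt_eq_one ⟨x, hx1⟩, inv_mul_cancel_left]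
      exact orderedProd_mem fun z hz =>
        mem_genSub _ (mem_of_cons_suffix_indices hM (by omega)) _

variable [IsDomain R] [Fact (2 ≤ c)]

/-- The homomorphism from the presented group to `N_{r,c}(R, f̄)`. -/
noncomputable def toQN : Presented P f →* QN P f :=
  PresentedGroup.toGroup (f := fun y => QN.gen P f y.1 y.2) <| by
    intro w hw
    cases hw with
    | commutator x y a b =>
      rw [map_mul, map_inv, mul_inv_eq_one, map_orderedProd]
      simpa [comm] using QN.comm_gen x y a b
    | add x hx a b => simpa [mul_inv_eq_one] using QN.gen_mul_gen x hx a b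
    | addOne j a b =>
      rw [map_mul, map_inv, mul_inv_eq_one, map_mul, map_mul, map_orderedProd]
      simpa using QN.gen_mul_gen_of_wt_eq_one j a b

theorem toQN_gen (x : Index U.n) (a : R) : toQN (gen P f x a) = QN.gen P f x a :=
  PresentedGroup.toGroup.of _

theorem toQN_orderedProd (a : Index U.n → R) :
    toQN (orderedProd 1 fun x => gen P f x (a x)) = ⟨a⟩ := by
  simp only [map_orderedProd, toQN_gen]
  exact QN.orderedProd_gen_coord (P := P) (f := f) ⟨a⟩

theorem toQN_bijective : Function.Bijective (toQN (P := P) (f := f)) := by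
  refine ⟨(injective_iff_map_eq_one _).2 fun w hw => ?_, fun g => ⟨_, toQN_orderedProd g.coord⟩⟩
  obtain ⟨a, rfl⟩ := exists_eq_orderedProd Fact.out w
  rw [toQN_orderedProd] at hw
  obtain rfl : a = 0 := congrArg QN.coord hw
  simp [gen_zero Fact.out, orderedProd]

end Presented

end Presentation

end HallCompletion

theorem mainTheorem8 {r c : ℕ} (hr : 2 ≤ r) (hc : 2 ≤ c)
    (U : HallCompletion.HallBasicSequence r c)
    {R : Type*} [CommRing R] [IsDomain R] [BinomialRing R]
    (f : HallCompletion.Layer U.n 1 →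
      HallCompletion.SymmetricCocycle R (HallCompletion.Layer U.n c → R)) :
    Nonempty (HallCompletion.CanonicalPolynomials U) ∧
    ∀ P : HallCompletion.CanonicalPolynomials U,
      ∃ _ : Group (HallCompletion.QN P f),
        (∀ g h : HallCompletion.QN P f, g * h = HallCompletion.QN.mul g h) ∧
        (∀ g : HallCompletion.QN P f, g⁻¹ = HallCompletion.QN.inv g) ∧
        Subgroup.closure
          {g | ∃ (x : HallCompletion.Index U.n) (a : R), g = HallCompletion.QN.gen P f x a} = ⊤ ∧
        ∃ e : PresentedGroup {w | HallCompletion.IsRelator P f w} ≃* HallCompletion.QN P f,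
          ∀ (x : HallCompletion.Index U.n) (a : R),
            e (PresentedGroup.of (x, a)) = HallCompletion.QN.gen P f x a := by
  have : Fact (2 ≤ c) := ⟨hc⟩
  exact ⟨U.nonempty_canonicalPolynomials, fun P => ⟨inferInstance, fun _ _ => rfl, fun _ => rfl,
    HallCompletion.QN.closure_gen,
    MulEquiv.ofBijective HallCompletion.Presented.toQN HallCompletion.Presented.toQN_bijective,
    HallCompletion.Presented.toQN_gen⟩⟩
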